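/- Let $p,n,m\ge 0$ be integers with $p\ge n+m+2$ and $m\le n$, and let $w_1^*,w_2^*\in\mathbb{R}^p$ with $\|w_1^*\|=\|w_2^*\|$ (Euclidean norm). For each task $t\in\{1,2\}$ there are $n$ training samples $(x_{t,i},y_{t,i})$, $1\le i\le n$, where all features $x_{t,i}\sim\mathcal{N}(0,I_p)$ are i.i.d. and the labels are noiseless, $y_{t,i}=x_{t,i}^\top w_t^*$. Let $M\subseteq\{1,\dots,n\}$ be a fixed set of $m$ indices; the samples $(x_{1,i},y_{1,i})_{i\in M}$ of task 1 are stored in a replay memory. Consider the continual learner that starts from $w_{(0)}=0$ and sets $$w_{(1)}=\operatorname*{arg\,min}_{w\in\mathbb{R}^p}\|w-w_{(0)}\|^2\ \text{ s.t. } x_{1,i}^\top w=y_{1,i}\ (1\le i\le n),$$ $$w_{(2)}=\operatorname*{arg\,min}_{w\in\mathbb{R}^p}\|w-w_{(1)}\|^2\ \text{ s.t. } x_{2,i}^\top w=y_{2,i}\ (1\le i\le n),\quad x_{1,i}^\top w=y_{1,i}\ (i\in M).$$ Almost surely both minimizers exist and are unique. With the loss $\mathcal{L}_t(w)=\|w-w_t^*\|^2$,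 the generalization error $G=\tfrac12\big(\mathcal{L}_1(w_{(2)})+\mathcal{L}_2(w_{(2)})\big)$ and the forgetting $F=\mathcal{L}_1(w_{(2)})-\mathcal{L}_1(w_{(1)})$ are integrable, and $$\mathbb{E}[G]=\frac{n}{2p}\Big(2-\frac{n-m}{p-m}+\frac{2m}{p-(n+m)-1}\Big)\|w_1^*-w_2^*\|^2+\Big(1-\frac{n}{p-m}\Big)\Big(1-\frac{n}{p}\Big)\|w_1^*\|^2,$$ $$\mathbb{E}[F]=\frac{n}{p}\Big(1+\frac{m}{p-(n+m)-1}\Big)\|w_1^*-w_2^*\|^2-\frac{n}{p-m}\Big(1-\frac{n}{p}\Big)\|w_1^*\|^2.$$ -/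

import Mathlib

open MeasureTheory ProbabilityTheory
open scoped NNReal

namespace ContinualLearning

/-- `ℝ^p` with the Euclidean norm and inner product. -/
abbrev Vec (p : ℕ) : Type := EuclideanSpace ℝ (Fin p)

/-- The random inputs of `T` linear regression tasks with `n` training samples each: i.i.d. features
`x t i ∼ N(0, I_p)` and, independently of them, i.i.d. label noise `z t i ∼ N(0, σ²)`. -/
structure IsGaussianData {Ω : Type*} [MeasurableSpace Ω] (μ : Measure Ω) {T n p : ℕ} (σ : ℝ≥0)
    (x : Fin T → Fin n → Ω → Vec p) (z : Fin T → Fin n → Ω → ℝ) : Prop where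
  feature_law : ∀ t i, HasLaw (x t i) (stdGaussian (Vec p)) μ
  noise_law : ∀ t i, HasLaw (z t i) (gaussianReal 0 (σ ^ 2)) μ
  feature_indep : iIndepFun (fun ti : Fin T × Fin n => x ti.1 ti.2) μ
  noise_indep : iIndepFun (fun ti : Fin T × Fin n => z ti.1 ti.2) μ
  feature_noise_indep : IndepFun (fun ω t i => x t i ω) (fun ω t i => z t i ω) μ

/-- The labels `y t i = ⟨x t i, w*_t⟩ + z t i` of the linear ground truth `wstar`. -/
noncomputable def labels {T n p : ℕ} (wstar : Fin T → Vec p) (x : Fin T → Fin n → Vec p)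
    (z : Fin T → Fin n → ℝ) (t : Fin T) (i : Fin n) : ℝ :=
  inner ℝ (x t i) (wstar t) + z t i

/-- The weights that fit exactly all the data of task `t` and, for every earlier task `s`, the
samples of task `s` kept in the replay memory, whose indices form the set `S s`. -/
def feasible {T n p : ℕ} (x : Fin T → Fin n → Vec p) (y : Fin T → Fin n → ℝ)
    (S : Fin T → Finset (Fin n)) (t : Fin T) : Set (Vec p) :=
  {w | (∀ i, inner ℝ (x t i) w = y t i) ∧ ∀ s < t, ∀ i ∈ S s, inner ℝ (x s i) w = y s i}

/-- `w` is the trajectory of the continual learner combining implicit regularization and replay: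
`w 0 = 0`, and the weights `w t.succ` after training on task `t` minimize the squared distance to
the previous weights `w t.castSucc` among all weights fitting the data of task `t` and the memory. -/
structure IsRegReplayLearner {T n p : ℕ} (x : Fin T → Fin n → Vec p) (y : Fin T → Fin n → ℝ)
    (S : Fin T → Finset (Fin n)) (w : Fin (T + 1) → Vec p) : Prop where
  init : w 0 = 0
  fit : ∀ t : Fin T, w t.succ ∈ feasible x y S t
  nearest : ∀ t : Fin T,
    IsMinOn (fun v : Vec p => ‖v - w t.castSucc‖ ^ 2) (feasible x y S t) (w t.succ)

/-- The generalization loss `𝓛_t(w) = ‖w - w*_t‖²` of the weights `w` on task `t`. -/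
noncomputable def loss {T p : ℕ} (wstar : Fin T → Vec p) (t : Fin T) (w : Vec p) : ℝ :=
  ‖w - wstar t‖ ^ 2

/-- The average generalization error `(1/T) ∑_t 𝓛_t(w)`. -/
noncomputable def generalizationError {T p : ℕ} (wstar : Fin T → Vec p) (w : Vec p) : ℝ :=
  1 / (T : ℝ) * ∑ t, loss wstar t w

/-- The average forgetting of a trajectory of weights: the mean over all tasks `t` but the last of
the loss on task `t` of the final weights minus that of the weights just after learning task `t`. -/
noncomputable def forgetting {T p : ℕ} (wstar : Fin T → Vec p) (w : Fin (T + 1) → Vec p) : ℝ :=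
  1 / ((T : ℝ) - 1) * ∑ t ∈ Finset.univ.filter (fun t : Fin T => (t : ℕ) + 1 < T),
    (loss wstar t (w (Fin.last T)) - loss wstar t (w t.succ))

end ContinualLearning

/-! Write `u`, `v` for the two ground truths, `d = v - u`, `X` and `B` for the features of the two
tasks, `C` for the replayed part of `X`, and `A` for the span of `C`. The first weights are `u - r`,
where `r` is the component of `u` orthogonal to the span of `X`. The second weights are `v + t - R
(r + d)`. Here `R` projects off the span of `C` and `B`, while `t` (`memoryCorrection`) lies in that
span, is orthogonal to `B`, and satisfies `⟪C i, t⟫ = -⟪C i, d⟫`: it repairs the labels in memory,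
which come from `u` and not from `v`.

Since `t` is orthogonal to the range of `R`, the loss on task 2 is `‖t‖² + ‖R (r + d)‖²` and that on
task 1 is `‖R r‖² + ‖d‖² - ‖R d‖² + 2⟪t, d⟫ + ‖t‖²`. These are averaged over `B` with `X` fixed,
then over `X`.

Three means over `B` are needed. Projected to `Aᗮ`, the vectors `B` are again standard Gaussian, so
`‖R ·‖²` is a squared distance to a random span (`lintegral_residual_sq`). Reflection in `Aᗮ` makes
the part of `t` in `Aᗮ` symmetric, so `⟪t, d⟫` has mean `-‖a‖²`, where `a` is the projection of `d`
to `A`. Finally `‖t‖² = ‖a‖⁴ / ‖b‖²`, where `b` is what remains of `a` after projecting off `B` and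
the part of `A` orthogonal to `a` (`norm_sq_memoryCorrection`); this calls for an inverse squared
distance (`lintegral_inv_residual_sq`), the source of the denominator `p - (n + m) - 1`.

Both distance moments follow from rotation invariance: the fixed vector may be replaced by a
Gaussian one, whose residual off a fixed span is Gaussian in the complement. Each moment becomes a
quotient of chi-squared moments. -/

namespace ContinualLearning

open scoped Matrix RealInnerProductSpace ENNReal
open Module

/-! ### Projection to the span of a family through its Gram matrix. -/

section Interpolation

variable {E : Type*} [NormedAddCommGroup E] [InnerProductSpace ℝ E]
variable {ι : Type*} [Fintype ι] [DecidableEq ι]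

/-- The point of the span of the vectors `Z i` with prescribed inner products `y i` with them
(when the `Z i` are linearly independent). -/
noncomputable def minNormInterp (Z : ι → E) (y : ι → ℝ) : E :=
  ∑ i, ((Matrix.gram ℝ Z)⁻¹ *ᵥ y) i • Z i

/-- The vector `v` minus its orthogonal projection to the span of the vectors `Z i`
(when these are linearly independent). -/
noncomputable def residual (Z : ι → E) (v : E) : E :=
  v - minNormInterp Z (fun i => ⟪Z i, v⟫)

lemma minNormInterp_mem_span (Z : ι → E) (y : ι → ℝ) :
    minNormInterp Z y ∈ Submodule.span ℝ (Set.range Z) :=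
  Submodule.sum_mem _ fun i _ => Submodule.smul_mem _ _ (Submodule.subset_span ⟨i, rfl⟩)

lemma inner_minNormInterp {Z : ι → E} (hZ : LinearIndependent ℝ Z) (y : ι → ℝ) (j : ι) :
    ⟪Z j, minNormInterp Z y⟫ = y j := by
  have hdet : IsUnit (Matrix.gram ℝ Z).det :=
    isUnit_iff_ne_zero.2 (Matrix.det_gram_ne_zero_iff_linearIndependent.2 hZ)
  have h : (Matrix.gram ℝ Z *ᵥ ((Matrix.gram ℝ Z)⁻¹ *ᵥ y)) j = y j := by
    rw [Matrix.mulVec_mulVec, Matrix.mul_nonsing_inv _ hdet, Matrix.one_mulVec]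
  rw [← h, minNormInterp, inner_sum]
  simp only [inner_smul_right]
  rw [Matrix.mulVec, dotProduct]
  exact Finset.sum_congr rfl fun i _ => by rw [Matrix.gram_apply, mul_comm]

lemma inner_residual {Z : ι → E} (hZ : LinearIndependent ℝ Z) (v : E) (j : ι) :
    ⟪Z j, residual Z v⟫ = 0 := by
  rw [residual, inner_sub_right, inner_minNormInterp hZ, sub_self]

lemma minNormInterp_map {F : Type*} [NormedAddCommGroup F] [InnerProductSpace ℝ F]
    (R : E →ₗᵢ[ℝ] F) (Z : ι → E) (y : ι → ℝ) :
    minNormInterp (fun i => R (Z i)) y = R (minNormInterp Z y) := by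
  have : Matrix.gram ℝ (fun i => R (Z i)) = Matrix.gram ℝ Z := by
    ext i j
    simp [Matrix.gram_apply]
  simp [minNormInterp, this]

lemma residual_map {F : Type*} [NormedAddCommGroup F] [InnerProductSpace ℝ F]
    (R : E →ₗᵢ[ℝ] F) (Z : ι → E) (v : E) :
    residual (fun i => R (Z i)) (R v) = R (residual Z v) := by
  simp [residual, minNormInterp_map]

lemma minNormInterp_smul (Z : ι → E) (c : ℝ) (y : ι → ℝ) :
    minNormInterp Z (fun i => c * y i) = c • minNormInterp Z y := by
  have : (fun i => c * y i) = c • y := rfl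
  rw [this, minNormInterp, Matrix.mulVec_smul, minNormInterp, Finset.smul_sum]
  simp [smul_smul]

lemma residual_smul (Z : ι → E) (c : ℝ) (v : E) : residual Z (c • v) = c • residual Z v := by
  simp only [residual, inner_smul_right, minNormInterp_smul, smul_sub]

/-- A vector orthogonal to all `Z i` that differs from `v` by a vector of their span is the residual
of `v`. -/
lemma eq_residual {Z : ι → E} (hZ : LinearIndependent ℝ Z) {v w : E}
    (hw : ∀ i, ⟪Z i, w⟫ = 0) (hvw : v - w ∈ Submodule.span ℝ (Set.range Z)) :
    w = residual Z v := by
  have h1 : w - residual Z v ∈ Submodule.span ℝ (Set.range Z) := by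
    have : w - residual Z v = minNormInterp Z (fun i => ⟪Z i, v⟫) - (v - w) := by
      rw [residual]; abel
    rw [this]
    exact Submodule.sub_mem _ (minNormInterp_mem_span _ _) hvw
  have h2 : w - residual Z v ∈ (Submodule.span ℝ (Set.range Z))ᗮ := by
    rw [Submodule.mem_orthogonal]
    intro u hu
    induction hu using Submodule.span_induction with
    | mem x hx =>
      obtain ⟨i, rfl⟩ := hx
      rw [inner_sub_right, hw, inner_residual hZ, sub_zero]
    | zero => simp
    | add x y _ _ hx hy => rw [inner_add_left, hx, hy, add_zero]
    | smul c x _ hx => rw [inner_smul_left, hx, mul_zero]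
  have h3 : w - residual Z v = 0 := by
    have := (Submodule.mem_orthogonal _ _).1 h2 _ h1
    rwa [inner_self_eq_zero] at this
  exact sub_eq_zero.1 h3

variable [MeasurableSpace E] [BorelSpace E] [FiniteDimensional ℝ E]

omit [Fintype ι] [DecidableEq ι] in
lemma measurable_gram_apply {X : Type*} [MeasurableSpace X] {f : X → ι → E} (hf : Measurable f)
    (i j : ι) : Measurable fun x => Matrix.gram ℝ (f x) i j := by
  have hi : Measurable fun x => f x i := (measurable_pi_apply i).comp hf
  have hj : Measurable fun x => f x j := (measurable_pi_apply j).comp hf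
  exact hi.inner hj

lemma measurable_det {X : Type*} [MeasurableSpace X] {M : X → Matrix ι ι ℝ}
    (hM : ∀ i j, Measurable fun x => M x i j) : Measurable fun x => (M x).det := by
  simp only [Matrix.det_apply]
  exact Finset.measurable_sum _ fun σ _ =>
    (Finset.measurable_prod _ fun i _ => hM _ _).const_smul _

lemma measurable_adjugate_apply {X : Type*} [MeasurableSpace X] {M : X → Matrix ι ι ℝ}
    (hM : ∀ i j, Measurable fun x => M x i j) (i j : ι) :
    Measurable fun x => (M x).adjugate i j := by
  simp only [Matrix.adjugate_apply]
  refine measurable_det fun k l => ?_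
  simp only [Matrix.updateRow_apply]
  split_ifs
  · exact measurable_const
  · exact hM k l

/-- By Cramer's rule the coefficients are adjugate entries times the inverse determinant, hence
measurable everywhere, including where the Gram matrix is singular and its inverse is 0 by
convention. -/
lemma measurable_minNormInterp {X : Type*} [MeasurableSpace X] {f : X → ι → E}
    {g : X → ι → ℝ} (hf : Measurable f) (hg : Measurable g) :
    Measurable fun x => minNormInterp (f x) (g x) := by
  have hdet := measurable_det (measurable_gram_apply hf)
  have hadj := measurable_adjugate_apply (measurable_gram_apply hf)
  unfold minNormInterp
  simp only [Matrix.mulVec, dotProduct, Matrix.inv_def, Matrix.smul_apply, Ring.inverse_eq_inv',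
    smul_eq_mul]
  have hf' : ∀ i, Measurable fun x => f x i := fun i => (measurable_pi_apply i).comp hf
  have hg' : ∀ i, Measurable fun x => g x i := fun i => (measurable_pi_apply i).comp hg
  fun_prop

lemma measurable_residual {X : Type*} [MeasurableSpace X] {f : X → ι → E}
    {g : X → E} (hf : Measurable f) (hg : Measurable g) :
    Measurable fun x => residual (f x) (g x) := by
  refine hg.sub (measurable_minNormInterp hf (measurable_pi_lambda _ fun i => ?_))
  exact ((measurable_pi_apply i).comp hf).inner hg

lemma measurableSet_linearIndependent {X : Type*} [MeasurableSpace X] {f : X → ι → E}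
    (hf : Measurable f) : MeasurableSet {x | LinearIndependent ℝ (f x)} := by
  have hdet := measurable_det (measurable_gram_apply hf)
  simp only [← Matrix.det_gram_ne_zero_iff_linearIndependent (𝕜 := ℝ)]
  exact hdet (measurableSet_singleton (0 : ℝ)).compl

end Interpolation

/-! ### Standard Gaussian vectors: projections, null sets, moments of the squared norm. -/

section Gaussian

variable {E : Type*} [NormedAddCommGroup E] [InnerProductSpace ℝ E] [FiniteDimensional ℝ E]
  [MeasurableSpace E] [BorelSpace E]

/-- The characteristic functions agree: for `t` in `K`, projecting `x` to `K` does not change `⟪x,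
t⟫`. -/
lemma stdGaussian_map_orthogonalProjection (K : Submodule ℝ E) :
    (stdGaussian E).map K.orthogonalProjectionOnto = stdGaussian K := by
  apply Measure.ext_of_charFun (E := K)
  ext t
  rw [charFun_apply, integral_map (by fun_prop) (by fun_prop), charFun_stdGaussian]
  have := charFun_stdGaussian (E := E) (t : E)
  rw [charFun_apply] at this
  simp only [Submodule.inner_orthogonalProjectionOnto_eq_of_mem_right]
  exact this

lemma stdGaussian_map_inner (v : E) :
    (stdGaussian E).map (fun x => ⟪v, x⟫) = gaussianReal 0 (‖v‖₊ ^ 2) := by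
  have h := IsGaussian.map_eq_gaussianReal (μ := stdGaussian E) (innerSL ℝ v)
  rw [variance_dual_stdGaussian, integral_strongDual_stdGaussian] at h
  convert! h using 2
  ext
  simp

/-- A proper subspace lies in some hyperplane orthogonal to a nonzero `v`, and the law of `⟪v, x⟫`
is a nondegenerate Gaussian, which has no atom at 0. -/
lemma stdGaussian_submodule_eq_zero {W : Submodule ℝ E} (hW : W ≠ ⊤) :
    stdGaussian E (W : Set E) = 0 := by
  have hne : Wᗮ ≠ ⊥ := fun h => hW (Submodule.orthogonal_eq_bot_iff.1 h)
  obtain ⟨v, hv, hv0⟩ := Submodule.exists_mem_ne_zero_of_ne_bot hne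
  have hsub : (W : Set E) ⊆ (fun x => ⟪v, x⟫) ⁻¹' {0} := fun x hx => by
    simpa using (Submodule.mem_orthogonal' _ _).1 hv x hx
  refine measure_mono_null hsub ?_
  rw [← Measure.map_apply (by fun_prop) (measurableSet_singleton _), stdGaussian_map_inner]
  have : NullSingletonClass (gaussianReal 0 (‖v‖₊ ^ 2)) := 
    nullSingletonClass_gaussianReal (by simpa using hv0)
  exact measure_singleton _

/-- Induction on `n`: the span of the vectors already drawn is a proper subspace, so a further
independent vector avoids it almost surely. -/
lemma ae_linearIndependent (n : ℕ) (hn : n ≤ finrank ℝ E) :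
    ∀ᵐ B ∂(Measure.pi fun _ : Fin n => stdGaussian E), LinearIndependent ℝ B := by
  induction n with
  | zero => exact Filter.Eventually.of_forall fun B => linearIndependent_empty_type
  | succ n ih =>
    have hmp := measurePreserving_piFinSuccAbove (fun _ : Fin (n + 1) => stdGaussian E) 0
    rw [← (hmp.symm).map_eq, ae_map_iff (MeasurableEquiv.measurable _).aemeasurable
      (p := fun B => LinearIndependent ℝ B) (measurableSet_linearIndependent measurable_id)]
    have hmeas : MeasurableSet {q : E × (Fin n → E) | LinearIndependent ℝ
        ((MeasurableEquiv.piFinSuccAbove (fun _ : Fin (n + 1) => E) 0).symm q)} :=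
      measurableSet_linearIndependent (MeasurableEquiv.measurable _)
    rw [← Measure.prod_swap, ae_map_iff (by fun_prop) hmeas, Measure.ae_prod_iff_ae_ae]
    · filter_upwards [ih (by omega)] with B hB
      have hW : Submodule.span ℝ (Set.range B) ≠ ⊤ := fun h => by
        have h1 := finrank_range_le_card (R := ℝ) B
        rw [Set.finrank, h, finrank_top] at h1
        simp at h1
        omega
      have h0 := stdGaussian_submodule_eq_zero hW
      filter_upwards [measure_eq_zero_iff_ae_notMem.1 h0] with x hx
      change LinearIndependent ℝ (Fin.insertNth 0 x B)
      rw [Fin.insertNth_zero']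
      exact linearIndependent_finCons.2 ⟨hB, hx⟩
    · exact measurable_swap hmeas

lemma integral_exp_neg_mul_sq_gaussianReal {t : ℝ} (ht : 0 ≤ t) :
    ∫ x, Real.exp (-t * x ^ 2) ∂(gaussianReal 0 1) = (1 + 2 * t) ^ (-(1 / 2) : ℝ) := by
  rw [integral_gaussianReal_eq_integral_smul one_ne_zero]
  have h : ∀ x : ℝ, gaussianPDFReal 0 1 x • Real.exp (-t * x ^ 2)
      = (√(2 * Real.pi))⁻¹ * Real.exp (-(t + 1 / 2) * x ^ 2) := fun x => by
    rw [gaussianPDFReal, smul_eq_mul, mul_assoc, ← Real.exp_add]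
    simp only [NNReal.coe_one]
    congr 2
    · simp
    · ring
  simp only [h]
  rw [integral_const_mul, integral_gaussian, ← Real.sqrt_inv, ← Real.sqrt_mul (by positivity),
    Real.rpow_neg (by positivity), ← Real.sqrt_eq_rpow, ← Real.sqrt_inv]
  congr 1
  field_simp
  ring

lemma integral_exp_neg_mul_norm_sq_stdGaussian {t : ℝ} (ht : 0 ≤ t) :
    ∫ x, Real.exp (-t * ‖x‖ ^ 2) ∂(stdGaussian E)
      = (1 + 2 * t) ^ (-((finrank ℝ E : ℝ) / 2)) := by
  rw [stdGaussian, integral_map (Measurable.aemeasurable (by fun_prop)) (by fun_prop)]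
  have h : ∀ x : Fin (finrank ℝ E) → ℝ,
      Real.exp (-t * ‖∑ i, x i • stdOrthonormalBasis ℝ E i‖ ^ 2)
        = ∏ i, Real.exp (-t * x i ^ 2) := fun x => by
    rw [← Real.exp_sum, ← Finset.mul_sum, ← real_inner_self_eq_norm_sq,
      (stdOrthonormalBasis ℝ E).orthonormal.inner_sum]
    simp [sq]
  simp only [h]
  rw [integral_fintype_prod_eq_prod (f := fun _ x => Real.exp (-t * x ^ 2))]
  simp only [integral_exp_neg_mul_sq_gaussianReal ht, Finset.prod_const, Finset.card_univ,
    Fintype.card_fin]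
  rw [← Real.rpow_mul_natCast (by positivity)]
  congr 1
  ring

lemma lintegral_Ioi_exp_neg_mul {s : ℝ} (hs : 0 ≤ s) :
    ∫⁻ t in Set.Ioi (0 : ℝ), ENNReal.ofReal (Real.exp (-t * s)) = (ENNReal.ofReal s)⁻¹ := by
  -- At `s = 0` both sides are infinite, so no exception is needed in `ℝ≥0∞`.
  rcases hs.eq_or_lt with rfl | hs
  · simp
  · have hs' : -s < 0 := by linarith
    have h := integral_exp_mul_Ioi hs' 0
    rw [← ofReal_integral_eq_lintegral_ofReal]
    · have : ∀ t : ℝ, Real.exp (-t * s) = Real.exp (-s * t) := fun t => by ring_nf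
      simp only [this, h]
      rw [← ENNReal.ofReal_inv_of_pos hs]
      simp
    · have := integrableOn_exp_mul_Ioi hs' 0
      refine this.congr_fun (fun t _ => ?_) measurableSet_Ioi
      ring_nf
    · exact Filter.Eventually.of_forall fun t => (Real.exp_pos _).le

lemma lintegral_Ioi_one_add_two_mul_rpow {k : ℝ} (hk : 2 < k) :
    ∫⁻ t in Set.Ioi (0 : ℝ), ENNReal.ofReal ((1 + 2 * t) ^ (-(k / 2)))
      = ENNReal.ofReal (1 / (k - 2)) := by
  -- An antiderivative; it tends to 0 at infinity because `1 - k / 2 < 0`, and its value at 0 is `-1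
  -- / (k - 2)`.
  have hd : ∀ t ∈ Set.Ici (0 : ℝ), HasDerivAt
      (fun t : ℝ => -(1 / (k - 2)) * (1 + 2 * t) ^ (1 - k / 2)) ((1 + 2 * t) ^ (-(k / 2))) t := by
    intro t ht
    have ht : (0 : ℝ) ≤ t := ht
    have h1 : HasDerivAt (fun t : ℝ => 1 + 2 * t) 2 t := by
      simpa using ((hasDerivAt_id t).const_mul 2).const_add 1
    have h2 := (h1.rpow_const (p := 1 - k / 2) (Or.inl (by positivity))).const_mul (-(1 / (k - 2)))
    convert! h2 using 1
    have : 1 - k / 2 - 1 = -(k / 2) := by ring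
    rw [this]
    have : k - 2 ≠ 0 := by linarith
    field_simp
    ring
  have hnn : ∀ t ∈ Set.Ioi (0 : ℝ), (0 : ℝ) ≤ (1 + 2 * t) ^ (-(k / 2)) := fun t ht => by
    have ht : (0 : ℝ) < t := ht
    positivity
  have hlim : Filter.Tendsto (fun t : ℝ => -(1 / (k - 2)) * (1 + 2 * t) ^ (1 - k / 2))
      Filter.atTop (nhds (-(1 / (k - 2)) * 0)) := by
    refine Filter.Tendsto.const_mul _ ?_
    have h1 : Filter.Tendsto (fun t : ℝ => 1 + 2 * t) Filter.atTop Filter.atTop :=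
      Filter.tendsto_atTop_add_const_left _ _
        (Filter.Tendsto.const_mul_atTop (by norm_num) Filter.tendsto_id)
    have h2 := (tendsto_rpow_neg_atTop (y := k / 2 - 1) (by linarith)).comp h1
    refine h2.congr fun t => ?_
    simp
  have hint := integrableOn_Ioi_deriv_of_nonneg' hd hnn hlim
  have hval := integral_Ioi_of_hasDerivAt_of_nonneg' hd hnn hlim
  rw [← ofReal_integral_eq_lintegral_ofReal hint
    ((ae_restrict_mem measurableSet_Ioi).mono hnn), hval]
  simp

/-- Write `1 / s` as the integral of `exp (-t * s)` over `t > 0` and exchange the integrals: what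
remains is the integral of the Laplace transform `(1 + 2t) ^ (-k / 2)` of the chi-squared law with
`k` degrees of freedom. -/
lemma lintegral_inv_norm_sq_stdGaussian (h : 3 ≤ finrank ℝ E) :
    ∫⁻ x, (ENNReal.ofReal (‖x‖ ^ 2))⁻¹ ∂(stdGaussian E)
      = ENNReal.ofReal (1 / ((finrank ℝ E : ℝ) - 2)) := by
  have hk : (2 : ℝ) < finrank ℝ E := by exact_mod_cast h
  simp only [← lintegral_Ioi_exp_neg_mul (sq_nonneg ‖_‖)]
  rw [lintegral_lintegral_swap (by fun_prop), ← lintegral_Ioi_one_add_two_mul_rpow hk]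
  refine setLIntegral_congr_fun measurableSet_Ioi fun t ht => ?_
  have ht : (0 : ℝ) < t := ht
  rw [← integral_exp_neg_mul_norm_sq_stdGaussian ht.le, ofReal_integral_eq_lintegral_ofReal]
  · refine Integrable.of_bound (C := 1) (by fun_prop) (Filter.Eventually.of_forall fun x => ?_)
    rw [Real.norm_of_nonneg (Real.exp_pos _).le, Real.exp_le_one_iff]
    nlinarith [sq_nonneg ‖x‖]
  · exact Filter.Eventually.of_forall fun t => (Real.exp_pos _).le

lemma lintegral_norm_sq_stdGaussian :
    ∫⁻ x, ENNReal.ofReal (‖x‖ ^ 2) ∂(stdGaussian E) = ENNReal.ofReal (finrank ℝ E) := by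
  have h1 : ∀ i, ∫⁻ x, ENNReal.ofReal (⟪stdOrthonormalBasis ℝ E i, x⟫ ^ 2) ∂(stdGaussian E)
      = 1 := fun i => by
    have hm := stdGaussian_map_inner (stdOrthonormalBasis ℝ E i)
    rw [(stdOrthonormalBasis ℝ E).nnnorm_eq_one, one_pow] at hm
    have hv : ∫ x, x ^ 2 ∂(gaussianReal 0 1) = 1 := by
      have := variance_id_gaussianReal (μ := 0) (v := 1)
      rw [variance_of_integral_eq_zero (by fun_prop) (by simp)] at this
      simpa using this
    have hi : Integrable (fun x : ℝ => x ^ 2) (gaussianReal 0 1) :=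
      (IsGaussian.memLp_two_id (μ := gaussianReal 0 1)).integrable_sq
    rw [← lintegral_map (f := fun y : ℝ => ENNReal.ofReal (y ^ 2)) (by fun_prop) (by fun_prop), hm,
      ← ofReal_integral_eq_lintegral_ofReal hi (Filter.Eventually.of_forall fun x => sq_nonneg x),
      hv, ENNReal.ofReal_one]
  have h2 : ∀ x : E, ENNReal.ofReal (‖x‖ ^ 2)
      = ∑ i, ENNReal.ofReal (⟪stdOrthonormalBasis ℝ E i, x⟫ ^ 2) := fun x => by
    rw [← (stdOrthonormalBasis ℝ E).sum_sq_inner_right x,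
      ENNReal.ofReal_sum_of_nonneg fun i _ => sq_nonneg _]
  simp only [h2]
  rw [lintegral_finsetSum _ (by fun_prop)]
  simp [h1]

end Gaussian

/-! ### Distance of a vector to the span of independent Gaussian vectors. -/

section RandomSubspace

variable {E : Type*} [NormedAddCommGroup E] [InnerProductSpace ℝ E] [FiniteDimensional ℝ E]
  [MeasurableSpace E] [BorelSpace E] {n : ℕ}

/-- The law of `n` independent standard Gaussian vectors. -/
noncomputable abbrev gaussianFamily (E : Type*) [NormedAddCommGroup E] [InnerProductSpace ℝ E]
    [FiniteDimensional ℝ E] [MeasurableSpace E] [BorelSpace E] (n : ℕ) : Measure (Fin n → E) :=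
  Measure.pi fun _ : Fin n => stdGaussian E

lemma measurePreserving_isometry (R : E ≃ₗᵢ[ℝ] E) :
    MeasurePreserving (fun B : Fin n → E => fun i => R (B i)) (gaussianFamily E n)
      (gaussianFamily E n) := by
  refine ⟨by fun_prop, ?_⟩
  have h := Measure.pi_map_pi (μ := fun _ : Fin n => stdGaussian E) (f := fun _ => R)
    (fun _ => by fun_prop)
  simp only [stdGaussian_map] at h
  exact h

lemma measurePreserving_orthogonalProjection (K : Submodule ℝ E) :
    MeasurePreserving (fun B : Fin n → E => fun i => K.orthogonalProjectionOnto (B i))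
      (gaussianFamily E n) (gaussianFamily K n) := by
  refine ⟨by fun_prop, ?_⟩
  have h := Measure.pi_map_pi (μ := fun _ : Fin n => stdGaussian E)
    (f := fun _ => K.orthogonalProjectionOnto) (fun _ => by fun_prop)
  simp only [stdGaussian_map_orthogonalProjection] at h
  exact h

/-- The reflection in the hyperplane orthogonal to `v - w` sends `v` to `w` and preserves the law of
the Gaussian family. -/
lemma lintegral_eq_of_norm_eq {F : E → (Fin n → E) → ℝ≥0∞} (hF : ∀ v, Measurable (F v))
    (hR : ∀ (R : E ≃ₗᵢ[ℝ] E) v B, F (R v) (fun i => R (B i)) = F v B) {v w : E}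
    (h : ‖v‖ = ‖w‖) : ∫⁻ B, F v B ∂gaussianFamily E n = ∫⁻ B, F w B ∂gaussianFamily E n := by
  let R : E ≃ₗᵢ[ℝ] E := (ℝ ∙ (v - w))ᗮ.reflection
  have hRv : R v = w := Submodule.reflection_sub h
  rw [← (measurePreserving_isometry R).lintegral_comp (hF w)]
  refine lintegral_congr fun B => ?_
  rw [← hR R v B, hRv]

/-- Averaging an isometry invariant function over the vector as well and exchanging the order of
integration. -/
lemma lintegral_mul_lintegral_scale {F : E → (Fin n → E) → ℝ≥0∞}
    (hF : Measurable (Function.uncurry F))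
    (hR : ∀ (R : E ≃ₗᵢ[ℝ] E) v B, F (R v) (fun i => R (B i)) = F v B)
    {s : ℝ → ℝ≥0∞} (hs : Measurable s)
    (hscale : ∀ c > 0, ∀ v B, F (c • v) B = s c * F v B) {v : E} (hv : v ≠ 0) :
    (∫⁻ B, F v B ∂gaussianFamily E n) * ∫⁻ w, s (‖w‖ / ‖v‖) ∂stdGaussian E
      = ∫⁻ B, ∫⁻ w, F w B ∂stdGaussian E ∂gaussianFamily E n := by
  have hFv : ∀ v, Measurable (F v) := fun v => hF.comp measurable_prodMk_left
  have hsn : Measurable fun w : E => s (‖w‖ / ‖v‖) := hs.comp (by fun_prop)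
  rw [← lintegral_const_mul _ hsn, lintegral_lintegral_swap
    (f := fun B w => F w B) (hF.comp measurable_swap).aemeasurable]
  have hbot : (⊥ : Submodule ℝ E) ≠ ⊤ := fun h => hv (by
    have : v ∈ (⊤ : Submodule ℝ E) := trivial
    rw [← h] at this
    simpa using this)
  have h0 := measure_eq_zero_iff_ae_notMem.1 (stdGaussian_submodule_eq_zero hbot)
  refine lintegral_congr_ae ?_
  filter_upwards [h0] with w hw
  have hw : w ≠ 0 := by simpa using hw
  have hc : 0 < ‖w‖ / ‖v‖ := div_pos (norm_pos_iff.2 hw) (norm_pos_iff.2 hv)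
  -- Invariance lets this multiple of `v` stand in for `w`; homogeneity then extracts the factor
  -- depending on `‖w‖`.
  have hnorm : ‖w‖ = ‖(‖w‖ / ‖v‖) • v‖ := by
    rw [norm_smul, Real.norm_of_nonneg hc.le, div_mul_cancel₀ _ (norm_ne_zero_iff.2 hv)]
  rw [lintegral_eq_of_norm_eq hFv hR hnorm]
  simp only [hscale _ hc]
  rw [lintegral_const_mul _ (hFv v), mul_comm]

omit [MeasurableSpace E] [BorelSpace E] in
lemma norm_residual_eq {B : Fin n → E} (hB : LinearIndependent ℝ B) (w : E) :
    ‖residual B w‖ = ‖(Submodule.span ℝ (Set.range B))ᗮ.orthogonalProjectionOnto w‖ := by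
  rw [← eq_residual hB (v := w)
    (w := (Submodule.span ℝ (Set.range B))ᗮ.orthogonalProjectionOnto w)]
  · rfl
  · intro i
    exact (Submodule.mem_orthogonal _ _).1 (Subtype.property _) _ (Submodule.subset_span ⟨i, rfl⟩)
  · have := Submodule.sub_starProjection_mem_orthogonal
      (K := (Submodule.span ℝ (Set.range B))ᗮ) w
    rwa [Submodule.orthogonal_orthogonal] at this

omit [MeasurableSpace E] [BorelSpace E] in
lemma finrank_orthogonal_span {B : Fin n → E} (hB : LinearIndependent ℝ B) :
    finrank ℝ (Submodule.span ℝ (Set.range B))ᗮ + n = finrank ℝ E := by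
  have h1 := Submodule.finrank_add_finrank_orthogonal (Submodule.span ℝ (Set.range B))
  rw [finrank_span_eq_card hB, Fintype.card_fin] at h1
  omega

/-- For fixed `B` the residual of a Gaussian vector is a standard Gaussian vector of the orthogonal
complement, so its squared norm is chi-squared. -/
lemma lintegral_norm_residual {B : Fin n → E} (hB : LinearIndependent ℝ B) {g : ℝ → ℝ≥0∞}
    (hg : Measurable g) :
    ∫⁻ w, g ‖residual B w‖ ∂stdGaussian E
      = ∫⁻ x, g ‖x‖ ∂stdGaussian (Submodule.span ℝ (Set.range B))ᗮ := by
  rw [← stdGaussian_map_orthogonalProjection, 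
    lintegral_map (f := fun x => g ‖x‖) (hg.comp measurable_norm) (by fun_prop)]
  simp only [norm_residual_eq hB]

omit [FiniteDimensional ℝ E] [MeasurableSpace E] [BorelSpace E] in
lemma residual_isometry (R : E ≃ₗᵢ[ℝ] E) (B : Fin n → E) (v : E) :
    ‖residual (fun i => R (B i)) (R v)‖ = ‖residual B v‖ := by
  have := residual_map R.toLinearIsometry B v
  simp only [LinearIsometryEquiv.coe_toLinearIsometry] at this
  rw [this, LinearIsometryEquiv.norm_map]

/-- The mean squared distance of a vector to the span of `n` independent Gaussian vectors. -/
theorem lintegral_residual_sq (hn : n ≤ finrank ℝ E) (v : E) :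
    ∫⁻ B, ENNReal.ofReal (‖residual B v‖ ^ 2) ∂gaussianFamily E n
      = ENNReal.ofReal (((finrank ℝ E : ℝ) - n) / finrank ℝ E * ‖v‖ ^ 2) := by
  rcases eq_or_ne v 0 with rfl | hv
  · have : ∀ B : Fin n → E, residual B 0 = 0 := fun B => by
      simpa using residual_smul B 0 0
    simp [this]
  have hq : 0 < finrank ℝ E := finrank_pos_iff_exists_ne_zero.2 ⟨v, hv⟩
  have hv0 : 0 < ‖v‖ := norm_pos_iff.2 hv
  have key := lintegral_mul_lintegral_scale (n := n)
    (F := fun (v : E) B => ENNReal.ofReal (‖residual B v‖ ^ 2))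
    (s := fun c => ENNReal.ofReal (c ^ 2))
    ((measurable_residual measurable_snd measurable_fst).norm.pow_const 2).ennreal_ofReal
    (fun R v B => by rw [residual_isometry]) (by fun_prop)
    (fun c hc v B => by
      rw [residual_smul, norm_smul, mul_pow, ENNReal.ofReal_mul (by positivity), Real.norm_eq_abs,
        sq_abs]) hv
  have hR : ∫⁻ B, ∫⁻ w, ENNReal.ofReal (‖residual B w‖ ^ 2) ∂stdGaussian E ∂gaussianFamily E n
      = ENNReal.ofReal ((finrank ℝ E : ℝ) - n) := by
    have : ∀ᵐ B ∂gaussianFamily E n, ∫⁻ w, ENNReal.ofReal (‖residual B w‖ ^ 2) ∂stdGaussian E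
        = ENNReal.ofReal ((finrank ℝ E : ℝ) - n) := by
      filter_upwards [ae_linearIndependent n hn] with B hB
      rw [lintegral_norm_residual hB (g := fun y => ENNReal.ofReal (y ^ 2)) (by fun_prop),
        lintegral_norm_sq_stdGaussian]
      congr 1
      rw [← finrank_orthogonal_span hB]
      push_cast
      ring
    rw [lintegral_congr_ae this, lintegral_const, measure_univ, mul_one]
  have hL : ∫⁻ w, ENNReal.ofReal ((‖w‖ / ‖v‖) ^ 2) ∂stdGaussian E
      = ENNReal.ofReal (finrank ℝ E / ‖v‖ ^ 2) := by
    simp only [div_pow, ENNReal.ofReal_div_of_pos (pow_pos hv0 2), div_eq_mul_inv (ENNReal.ofReal _)]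
    rw [lintegral_mul_const _ (by fun_prop), lintegral_norm_sq_stdGaussian]
  rw [hR, hL] at key
  have hpos : (0 : ℝ) < finrank ℝ E / ‖v‖ ^ 2 := by positivity
  rw [mul_comm, ← ENNReal.eq_div_iff (by simpa using hpos) ENNReal.ofReal_ne_top,
    ← ENNReal.ofReal_div_of_pos hpos] at key
  · rw [key]
    congr 1
    field_simp

/-- The mean inverse squared distance of a vector to the span of `n` independent Gaussian
vectors. -/
theorem lintegral_inv_residual_sq (hn : n + 3 ≤ finrank ℝ E) {v : E} (hv : v ≠ 0) :
    ∫⁻ B, (ENNReal.ofReal (‖residual B v‖ ^ 2))⁻¹ ∂gaussianFamily E n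
      = ENNReal.ofReal (((finrank ℝ E : ℝ) - 2) / ((finrank ℝ E : ℝ) - n - 2) / ‖v‖ ^ 2) := by
  have hq : (n : ℝ) + 3 ≤ finrank ℝ E := by exact_mod_cast hn
  have hq2 : (0 : ℝ) < (finrank ℝ E : ℝ) - 2 := by
    have : (0 : ℝ) ≤ n := n.cast_nonneg
    linarith
  have hqn : (0 : ℝ) < (finrank ℝ E : ℝ) - n - 2 := by linarith
  have hv0 : 0 < ‖v‖ := norm_pos_iff.2 hv
  have key := lintegral_mul_lintegral_scale (n := n)
    (F := fun (v : E) B => (ENNReal.ofReal (‖residual B v‖ ^ 2))⁻¹)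
    (s := fun c => (ENNReal.ofReal (c ^ 2))⁻¹)
    ((measurable_residual measurable_snd measurable_fst).norm.pow_const 2).ennreal_ofReal.inv
    (fun R v B => by rw [residual_isometry]) (by fun_prop)
    (fun c hc v B => by
      rw [residual_smul, norm_smul, mul_pow, ENNReal.ofReal_mul (by positivity), Real.norm_eq_abs,
        sq_abs, ENNReal.mul_inv (Or.inl (by simpa using hc.ne'))
          (Or.inl ENNReal.ofReal_ne_top)]) hv
  have hR : ∫⁻ B, ∫⁻ w, (ENNReal.ofReal (‖residual B w‖ ^ 2))⁻¹ ∂stdGaussian E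
      ∂gaussianFamily E n = ENNReal.ofReal (1 / ((finrank ℝ E : ℝ) - n - 2)) := by
    have : ∀ᵐ B ∂gaussianFamily E n, ∫⁻ w, (ENNReal.ofReal (‖residual B w‖ ^ 2))⁻¹ ∂stdGaussian E
        = ENNReal.ofReal (1 / ((finrank ℝ E : ℝ) - n - 2)) := by
      filter_upwards [ae_linearIndependent n (by omega)] with B hB
      have hd := finrank_orthogonal_span hB
      rw [lintegral_norm_residual hB (g := fun y => (ENNReal.ofReal (y ^ 2))⁻¹) (by fun_prop),
        lintegral_inv_norm_sq_stdGaussian (by omega)]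
      congr 2
      rw [← hd]
      push_cast
      ring
    rw [lintegral_congr_ae this, lintegral_const, measure_univ, mul_one]
  have hL : ∫⁻ w, (ENNReal.ofReal ((‖w‖ / ‖v‖) ^ 2))⁻¹ ∂stdGaussian E
      = ENNReal.ofReal (‖v‖ ^ 2 / ((finrank ℝ E : ℝ) - 2)) := by
    have hv2 : 0 < ‖v‖ ^ 2 := pow_pos hv0 2
    have : ∀ w : E, (ENNReal.ofReal ((‖w‖ / ‖v‖) ^ 2))⁻¹
        = ENNReal.ofReal (‖v‖ ^ 2) * (ENNReal.ofReal (‖w‖ ^ 2))⁻¹ := fun w => by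
      rw [div_pow, ENNReal.ofReal_div_of_pos hv2, ENNReal.inv_div (Or.inl ENNReal.ofReal_ne_top)
        (Or.inl (by simpa using hv)), div_eq_mul_inv]
    simp only [this]
    rw [lintegral_const_mul _ (by fun_prop), lintegral_inv_norm_sq_stdGaussian (by omega),
      ← ENNReal.ofReal_mul hv2.le]
    congr 1
    ring
  rw [hR, hL] at key
  have hpos : (0 : ℝ) < ‖v‖ ^ 2 / ((finrank ℝ E : ℝ) - 2) := by positivity
  rw [mul_comm, ← ENNReal.eq_div_iff (by simpa using hpos) ENNReal.ofReal_ne_top,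
    ← ENNReal.ofReal_div_of_pos hpos] at key
  · rw [key]
    congr 1
    field_simp

end RandomSubspace

/-! ### Linearity and orthogonality of residuals. -/

section Geometry

variable {E : Type*} [NormedAddCommGroup E] [InnerProductSpace ℝ E]
variable {ι : Type*} [Fintype ι] [DecidableEq ι]

lemma minNormInterp_add (Z : ι → E) (y y' : ι → ℝ) :
    minNormInterp Z (y + y') = minNormInterp Z y + minNormInterp Z y' := by
  simp only [minNormInterp, Matrix.mulVec_add, Pi.add_apply, add_smul, Finset.sum_add_distrib]

lemma residual_add (Z : ι → E) (v w : E) :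
    residual Z (v + w) = residual Z v + residual Z w := by
  have : (fun i => ⟪Z i, v + w⟫) = (fun i => ⟪Z i, v⟫) + fun i => ⟪Z i, w⟫ := by
    ext i
    simp [inner_add_right]
  rw [residual, this, minNormInterp_add, residual, residual]
  abel

omit [Fintype ι] [DecidableEq ι] in
lemma inner_eq_zero_of_mem_span {Z : ι → E} {w : E} (hw : ∀ i, ⟪Z i, w⟫ = 0) {u : E}
    (hu : u ∈ Submodule.span ℝ (Set.range Z)) : ⟪u, w⟫ = 0 := by
  induction hu using Submodule.span_induction with
  | mem x hx =>
    obtain ⟨i, rfl⟩ := hx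
    exact hw i
  | zero => simp
  | add x y _ _ hx hy => rw [inner_add_left, hx, hy, add_zero]
  | smul c x _ hx => rw [inner_smul_left, hx, mul_zero]

lemma eq_minNormInterp {Z : ι → E} (hZ : LinearIndependent ℝ Z) {y : ι → ℝ} {w : E}
    (hw : ∀ i, ⟪Z i, w⟫ = y i) (hs : w ∈ Submodule.span ℝ (Set.range Z)) :
    w = minNormInterp Z y := by
  have h := inner_eq_zero_of_mem_span (Z := Z) (w := w - minNormInterp Z y)
    (fun i => by rw [inner_sub_right, hw, inner_minNormInterp hZ, sub_self])
    (Submodule.sub_mem _ hs (minNormInterp_mem_span Z y))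
  exact sub_eq_zero.1 (inner_self_eq_zero.1 h)

lemma inner_mem_span_residual {Z : ι → E} (hZ : LinearIndependent ℝ Z) (v : E) {u : E}
    (hu : u ∈ Submodule.span ℝ (Set.range Z)) : ⟪u, residual Z v⟫ = 0 :=
  inner_eq_zero_of_mem_span (inner_residual hZ v) hu

lemma inner_self_residual {Z : ι → E} (hZ : LinearIndependent ℝ Z) (v : E) :
    ⟪v, residual Z v⟫ = ‖residual Z v‖ ^ 2 := by
  have h := inner_mem_span_residual hZ v (minNormInterp_mem_span Z fun i => ⟪Z i, v⟫)
  rw [← real_inner_self_eq_norm_sq]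
  nth_rw 2 [residual]
  rw [inner_sub_left, h, sub_zero]

end Geometry

/-! ### Geometry of the memory correction. -/

section Replay

variable {E : Type*} [NormedAddCommGroup E] [InnerProductSpace ℝ E] [FiniteDimensional ℝ E]
  {m n : ℕ}

/-- The element `t` of the span of the `C i` and the `B j` that is orthogonal to the `B j` and such
that `t + d` is orthogonal to the `C i`. -/
noncomputable def memoryCorrection (C : Fin m → E) (B : Fin n → E) (d : E) : E :=
  minNormInterp (Sum.elim C B) (Sum.elim (fun i => -⟪C i, d⟫) 0)

/-- A combination of the `B i` lying in the span of `C` projects to 0 in the complement, so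
independence of the projections kills its coefficients. -/
lemma linearIndependent_elim {C : Fin m → E} {B : Fin n → E} (hC : LinearIndependent ℝ C)
    (hB : LinearIndependent ℝ fun j =>
      (Submodule.span ℝ (Set.range C))ᗮ.orthogonalProjectionOnto (B j)) :
    LinearIndependent ℝ (Sum.elim C B) := by
  set K := (Submodule.span ℝ (Set.range C))ᗮ with hK
  have hB' : LinearIndependent ℝ B :=
    LinearIndependent.of_comp K.orthogonalProjectionOnto.toLinearMap hB
  refine hC.sum_type hB' ?_
  rw [Submodule.disjoint_def]
  intro x hxC hxB
  obtain ⟨c, rfl⟩ := (Submodule.mem_span_range_iff_exists_fun ℝ).1 hxB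
  have h0 : K.orthogonalProjectionOnto (∑ i, c i • B i) = 0 :=
    Submodule.orthogonalProjectionOnto_apply_of_mem_orthogonal (by
      rw [hK, Submodule.orthogonal_orthogonal]
      exact hxC)
  rw [map_sum] at h0
  simp only [map_smul] at h0
  have := Fintype.linearIndependent_iff.1 hB c h0
  simp [this]

omit [FiniteDimensional ℝ E] in
lemma span_range_left_le (C : Fin m → E) (B : Fin n → E) :
    Submodule.span ℝ (Set.range C) ≤ Submodule.span ℝ (Set.range (Sum.elim C B)) := by
  rw [Set.Sum.elim_range]
  exact Submodule.span_mono Set.subset_union_left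

/-- The projection to `Vᗮ` of the span of the projections of the `B j` lies in `V ⊔ span B`. -/
lemma coe_mem_of_mem_span_projection {V U : Submodule ℝ E} {B : Fin n → E} (hV : V ≤ U)
    (hB : ∀ j, B j ∈ U) {x : Vᗮ}
    (hx : x ∈ Submodule.span ℝ (Set.range fun j => Vᗮ.orthogonalProjectionOnto (B j))) :
    (x : E) ∈ U := by
  induction hx using Submodule.span_induction with
  | mem x hx =>
    obtain ⟨j, rfl⟩ := hx
    have h : ((Vᗮ.orthogonalProjectionOnto (B j) : Vᗮ) : E) = B j - V.starProjection (B j) :=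
      Submodule.starProjection_orthogonal_val (B j)
    rw [h]
    exact U.sub_mem (hB j) (hV (Submodule.starProjection_apply_mem _ _))
  | zero => exact U.zero_mem
  | add x y _ _ hx hy => exact U.add_mem hx hy
  | smul c x _ hx => exact U.smul_mem c hx

/-- Projecting off `C` and `B` can be done in two stages, the second inside the complement of `C`.
For fixed `C` and Gaussian `B`, the second stage involves a standard Gaussian family of that
complement. -/
lemma residual_elim {C : Fin m → E} {B : Fin n → E} (hC : LinearIndependent ℝ C)
    (hB : LinearIndependent ℝ fun j =>
      (Submodule.span ℝ (Set.range C))ᗮ.orthogonalProjectionOnto (B j)) (v : E) :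
    residual (Sum.elim C B) v = residual (fun j =>
      (Submodule.span ℝ (Set.range C))ᗮ.orthogonalProjectionOnto (B j))
      ((Submodule.span ℝ (Set.range C))ᗮ.orthogonalProjectionOnto v) := by
  set A := Submodule.span ℝ (Set.range C) with hA
  set R := residual (fun j => Aᗮ.orthogonalProjectionOnto (B j))
    (Aᗮ.orthogonalProjectionOnto v) with hR
  symm
  refine eq_residual (linearIndependent_elim hC hB) ?_ ?_
  · rintro (i | j)
    · exact (Submodule.mem_orthogonal _ _).1 R.2 _ (Submodule.subset_span ⟨i, rfl⟩)
    · have := inner_residual hB (Aᗮ.orthogonalProjectionOnto v) j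
      rwa [← hR, Submodule.inner_orthogonalProjectionOnto_eq_of_mem_right] at this
  · have h1 : v - (R : E) = A.starProjection v + ((minNormInterp
        (fun j => Aᗮ.orthogonalProjectionOnto (B j)) (fun j =>
          ⟪Aᗮ.orthogonalProjectionOnto (B j), Aᗮ.orthogonalProjectionOnto v⟫) : Aᗮ) : E) := by
      have h : ((Aᗮ.orthogonalProjectionOnto v : Aᗮ) : E) = v - A.starProjection v :=
        Submodule.starProjection_orthogonal_val v
      rw [hR, residual, Submodule.coe_sub, h]
      abel
    rw [h1]
    refine Submodule.add_mem _ (span_range_left_le C B (Submodule.starProjection_apply_mem _ _))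
      (coe_mem_of_mem_span_projection (span_range_left_le C B) (fun j => ?_)
        (minNormInterp_mem_span _ _))
    exact Submodule.subset_span ⟨Sum.inr j, rfl⟩

omit [FiniteDimensional ℝ E] in
lemma inner_memoryCorrection_left {C : Fin m → E} {B : Fin n → E}
    (h : LinearIndependent ℝ (Sum.elim C B)) (d : E) {c : E}
    (hc : c ∈ Submodule.span ℝ (Set.range C)) : ⟪c, memoryCorrection C B d⟫ = -⟪c, d⟫ := by
  have := inner_eq_zero_of_mem_span (Z := C) (w := memoryCorrection C B d + d) (fun i => by
    have := inner_minNormInterp h (Sum.elim (fun i => -⟪C i, d⟫) 0) (Sum.inl i)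
    simp only [Sum.elim_inl] at this
    rw [inner_add_right, memoryCorrection, this]
    ring) hc
  rw [inner_add_right] at this
  linarith

omit [FiniteDimensional ℝ E] in
lemma inner_memoryCorrection_right {C : Fin m → E} {B : Fin n → E}
    (h : LinearIndependent ℝ (Sum.elim C B)) (d : E) (j : Fin n) :
    ⟪B j, memoryCorrection C B d⟫ = 0 :=
  inner_minNormInterp h (Sum.elim (fun i => -⟪C i, d⟫) 0) (Sum.inr j)

omit [FiniteDimensional ℝ E] in
lemma memoryCorrection_mem_span (C : Fin m → E) (B : Fin n → E) (d : E) :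
    memoryCorrection C B d ∈ Submodule.span ℝ (Set.range (Sum.elim C B)) :=
  minNormInterp_mem_span _ _

/-- The explicit form of the correction in terms of the component of `a`, the projection of `d` to
the memory span, that is orthogonal to the rest of the memory and to the `B j`. -/
lemma norm_sq_memoryCorrection {C : Fin m → E} {B : Fin n → E}
    (h : LinearIndependent ℝ (Sum.elim C B)) {d a : E}
    (ha : a = (Submodule.span ℝ (Set.range C)).starProjection d)
    {V : Submodule ℝ E} (hV : V = (ℝ ∙ a)ᗮ ⊓ Submodule.span ℝ (Set.range C))
    (hB : LinearIndependent ℝ fun j => Vᗮ.orthogonalProjectionOnto (B j))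
    (haV : a ∈ Vᗮ) (hne : residual (fun j => Vᗮ.orthogonalProjectionOnto (B j)) ⟨a, haV⟩ ≠ 0) :
    ‖memoryCorrection C B d‖ ^ 2 = ‖a‖ ^ 4
      / ‖residual (fun j => Vᗮ.orthogonalProjectionOnto (B j)) ⟨a, haV⟩‖ ^ 2 := by
  set A := Submodule.span ℝ (Set.range C) with hA
  set b := residual (fun j => Vᗮ.orthogonalProjectionOnto (B j)) ⟨a, haV⟩ with hb
  have hb0 : ‖b‖ ≠ 0 := norm_ne_zero_iff.2 hne
  have haA : a ∈ A := ha ▸ Submodule.starProjection_apply_mem _ _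
  have ha0 : a ≠ 0 := by
    rintro rfl
    apply hne
    have : (⟨0, haV⟩ : Vᗮ) = 0 := rfl
    rw [hb, this]
    simpa using residual_smul (fun j => Vᗮ.orthogonalProjectionOnto (B j)) 0 0
  have ha0' : ‖a‖ ≠ 0 := norm_ne_zero_iff.2 ha0
  have hVA : V ≤ A := hV ▸ inf_le_right
  have hab : ⟪a, (b : E)⟫ = ‖b‖ ^ 2 := inner_self_residual hB ⟨a, haV⟩
  have hbB : ∀ j, ⟪B j, (b : E)⟫ = 0 := fun j => by
    have := inner_residual hB ⟨a, haV⟩ j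
    rwa [← hb, Submodule.inner_orthogonalProjectionOnto_eq_of_mem_right] at this
  have hcb : ∀ c ∈ A, ⟪c, (b : E)⟫ = ⟪c, a⟫ / ‖a‖ ^ 2 * ‖b‖ ^ 2 := fun c hc => by
    -- Within `A`, only the component along `a` pairs with `b`: the rest lies in `V`, to which `b`
    -- is orthogonal.
    have hc' : c - (⟪c, a⟫ / ‖a‖ ^ 2) • a ∈ V := by
      rw [hV]
      refine Submodule.mem_inf.2 ⟨?_, A.sub_mem hc (A.smul_mem _ haA)⟩
      rw [Submodule.mem_orthogonal_singleton_iff_inner_left, inner_sub_left, inner_smul_left,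
        real_inner_self_eq_norm_sq]
      simp only [RCLike.conj_to_real]
      field_simp
      ring
    have h0 := (Submodule.mem_orthogonal _ _).1 b.2 _ hc'
    rw [inner_sub_left, inner_smul_left, hab] at h0
    simp only [RCLike.conj_to_real] at h0
    linarith
  have hbU : (b : E) ∈ Submodule.span ℝ (Set.range (Sum.elim C B)) := by
    rw [hb, residual, Submodule.coe_sub]
    refine Submodule.sub_mem _ (span_range_left_le C B haA)
      (coe_mem_of_mem_span_projection (hVA.trans (span_range_left_le C B)) (fun j => ?_)
        (minNormInterp_mem_span _ _))
    exact Submodule.subset_span ⟨Sum.inr j, rfl⟩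
  -- The factor is forced by `⟪a, b⟫ = ‖b‖²` and the requirement that the pairing with `a` be
  -- `-‖a‖²`.
  have key : (-(‖a‖ ^ 2 / ‖b‖ ^ 2)) • (b : E) = memoryCorrection C B d := by
    refine eq_minNormInterp h ?_ (Submodule.smul_mem _ _ hbU)
    rintro (i | j)
    · have hi : C i ∈ A := Submodule.subset_span ⟨i, rfl⟩
      have hd : ⟪C i, a⟫ = ⟪C i, d⟫ := by
        rw [ha, ← Submodule.inner_starProjection_left_eq_right,
          Submodule.starProjection_eq_self_iff.2 hi]
      simp only [Sum.elim_inl]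
      rw [inner_smul_right, hcb _ hi, hd]
      field_simp
    · simp only [Sum.elim_inr, Pi.zero_apply]
      rw [inner_smul_right, hbB, mul_zero]
  rw [← key, norm_smul, mul_pow, Real.norm_eq_abs, sq_abs, Submodule.coe_norm]
  field_simp

/-- The reflection fixes `Aᗮ` and negates `A`, hence negates the pairings with `C`; the outer sign
restores them and is harmless for the homogeneous conditions on `B`. -/
lemma memoryCorrection_reflection {C : Fin m → E} {B : Fin n → E}
    (h : LinearIndependent ℝ (Sum.elim C B)) (d : E)
    (h' : LinearIndependent ℝ (Sum.elim C fun j =>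
      (Submodule.span ℝ (Set.range C))ᗮ.reflection (B j))) :
    memoryCorrection C (fun j => (Submodule.span ℝ (Set.range C))ᗮ.reflection (B j)) d
      = -(Submodule.span ℝ (Set.range C))ᗮ.reflection (memoryCorrection C B d) := by
  set A := Submodule.span ℝ (Set.range C) with hA
  have hCA : ∀ i, C i ∈ A := fun i => Submodule.subset_span ⟨i, rfl⟩
  have hrC : ∀ i, Aᗮ.reflection (C i) = -C i := fun i =>
    Submodule.reflection_mem_subspace_orthogonal_precomplement_eq_neg (hCA i)
  symm
  refine eq_minNormInterp h' ?_ ?_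
  · rintro (i | j)
    · have h1 : ⟪C i, Aᗮ.reflection (memoryCorrection C B d)⟫ = ⟪C i, d⟫ := by
        have h2 : C i = Aᗮ.reflection (-C i) := by rw [map_neg, hrC, neg_neg]
        nth_rw 1 [h2]
        rw [LinearIsometryEquiv.inner_map_map, inner_neg_left,
          inner_memoryCorrection_left h d (hCA i), neg_neg]
      simp only [Sum.elim_inl]
      rw [inner_neg_right, h1]
    · simp only [Sum.elim_inr, Pi.zero_apply]
      rw [inner_neg_right, LinearIsometryEquiv.inner_map_map, inner_memoryCorrection_right h,
        neg_zero]
  · refine Submodule.neg_mem _ ?_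
    have hmem := memoryCorrection_mem_span C B d
    generalize memoryCorrection C B d = t at hmem
    induction hmem using Submodule.span_induction with
    | mem x hx =>
      obtain ⟨i | j, rfl⟩ := hx
      · rw [Sum.elim_inl, hrC]
        exact Submodule.neg_mem _ (Submodule.subset_span ⟨Sum.inl i, rfl⟩)
      · exact Submodule.subset_span ⟨Sum.inr j, rfl⟩
    | zero => rw [map_zero]; exact Submodule.zero_mem _
    | add x y _ _ hx hy => rw [map_add]; exact Submodule.add_mem _ hx hy
    | smul c x _ hx => rw [map_smul]; exact Submodule.smul_mem _ _ hx

end Replay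

/-! ### Means over the second task with the memory fixed. -/

section Expectation

lemma integrable_and_integral_of_lintegral_ofReal {X : Type*} [MeasurableSpace X] {μ : Measure X}
    {f : X → ℝ} (hf : AEStronglyMeasurable f μ) (hf0 : ∀ᵐ x ∂μ, 0 ≤ f x) {c : ℝ} (hc : 0 ≤ c)
    (h : ∫⁻ x, ENNReal.ofReal (f x) ∂μ = ENNReal.ofReal c) :
    Integrable f μ ∧ ∫ x, f x ∂μ = c := by
  refine ⟨⟨hf, ?_⟩, ?_⟩
  · rw [hasFiniteIntegral_iff_ofReal hf0, h]
    exact ENNReal.ofReal_lt_top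
  · rw [integral_eq_lintegral_of_nonneg_ae hf0 hf, h, ENNReal.toReal_ofReal hc]

variable {E : Type*} [NormedAddCommGroup E] [InnerProductSpace ℝ E] [FiniteDimensional ℝ E]
  [MeasurableSpace E] [BorelSpace E] {m n : ℕ}

omit [NormedAddCommGroup E] [InnerProductSpace ℝ E] [FiniteDimensional ℝ E] [BorelSpace E] in
lemma measurable_sumElim {X : Type*} [MeasurableSpace X] {f : X → Fin m → E} {g : X → Fin n → E}
    (hf : Measurable f) (hg : Measurable g) : Measurable fun x => Sum.elim (f x) (g x) := by
  refine measurable_pi_lambda _ ?_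
  rintro (i | j)
  · exact (measurable_pi_apply i).comp hf
  · exact (measurable_pi_apply j).comp hg

lemma measurable_memoryCorrection {X : Type*} [MeasurableSpace X] {f : X → Fin m → E}
    {g : X → Fin n → E} (hf : Measurable f) (hg : Measurable g) (d : E) :
    Measurable fun x => memoryCorrection (f x) (g x) d := by
  refine measurable_minNormInterp (measurable_sumElim hf hg) (measurable_pi_lambda _ ?_)
  rintro (i | j)
  · exact (((measurable_pi_apply i).comp hf).inner measurable_const).neg
  · exact measurable_const

lemma ae_linearIndependent_projection (K : Submodule ℝ E) (hn : n ≤ finrank ℝ K) :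
    ∀ᵐ B ∂gaussianFamily E n, LinearIndependent ℝ fun j => K.orthogonalProjectionOnto (B j) :=
  (measurePreserving_orthogonalProjection K).quasiMeasurePreserving.ae
    (ae_linearIndependent n hn)

lemma ae_linearIndependent_elim {C : Fin m → E} (hC : LinearIndependent ℝ C)
    (h : m + n ≤ finrank ℝ E) :
    ∀ᵐ B ∂gaussianFamily E n, LinearIndependent ℝ (Sum.elim C B) := by
  have := finrank_orthogonal_span hC
  filter_upwards [ae_linearIndependent_projection (n := n)
    (Submodule.span ℝ (Set.range C))ᗮ (by omega)] with B hB
  exact linearIndependent_elim hC hB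

/-- Projecting off the memory and `n` Gaussian vectors. -/
lemma integral_residual_elim_sq {C : Fin m → E} (hC : LinearIndependent ℝ C)
    (h : m + n ≤ finrank ℝ E) (v : E) :
    Integrable (fun B => ‖residual (Sum.elim C B) v‖ ^ 2) (gaussianFamily E n) ∧
    ∫ B, ‖residual (Sum.elim C B) v‖ ^ 2 ∂gaussianFamily E n
      = ((finrank ℝ E : ℝ) - m - n) / ((finrank ℝ E : ℝ) - m)
        * ‖(Submodule.span ℝ (Set.range C))ᗮ.starProjection v‖ ^ 2 := by
  set K := (Submodule.span ℝ (Set.range C))ᗮ with hK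
  have hd : finrank ℝ K + m = finrank ℝ E := finrank_orthogonal_span hC
  have hd' : (finrank ℝ K : ℝ) = (finrank ℝ E : ℝ) - m := by
    rw [← hd]
    push_cast
    ring
  have hn : (n : ℝ) ≤ finrank ℝ K := by
    have : n ≤ finrank ℝ K := by omega
    exact_mod_cast this
  have hnorm : ‖K.starProjection v‖ = ‖K.orthogonalProjectionOnto v‖ := rfl
  rw [← hd', hnorm]
  refine integrable_and_integral_of_lintegral_ofReal ?_
    (Filter.Eventually.of_forall fun B => sq_nonneg _) ?_ ?_
  · exact ((measurable_residual (measurable_sumElim measurable_const measurable_id)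
      measurable_const).norm.pow_const 2).aestronglyMeasurable
  · have : 0 ≤ (finrank ℝ K : ℝ) - n := by linarith
    positivity
  · rw [← lintegral_residual_sq (by omega), ← (measurePreserving_orthogonalProjection K).lintegral_comp]
    · refine lintegral_congr_ae ?_
      filter_upwards [ae_linearIndependent_projection (n := n) K (by omega)] with B hB
      rw [residual_elim hC hB]
      rfl
    · exact ((measurable_residual measurable_id
        measurable_const).norm.pow_const 2).ennreal_ofReal

/-- Apply the inverse moment in `Vᗮ`, with `V` as in `norm_sq_memoryCorrection`. Its dimension is
`finrank ℝ E - m + 1`, so `n + m + 2 ≤ finrank ℝ E` is exactly the condition `n + 3 ≤ finrank ℝ Vᗮ`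
needed there. -/
lemma integral_memoryCorrection_sq {C : Fin m → E} (hC : LinearIndependent ℝ C)
    (h : n + m + 2 ≤ finrank ℝ E) (d : E) :
    Integrable (fun B => ‖memoryCorrection C B d‖ ^ 2) (gaussianFamily E n) ∧
    ∫ B, ‖memoryCorrection C B d‖ ^ 2 ∂gaussianFamily E n
      = ((finrank ℝ E : ℝ) - m - 1) / ((finrank ℝ E : ℝ) - (n + m) - 1)
        * ‖(Submodule.span ℝ (Set.range C)).starProjection d‖ ^ 2 := by
  set A := Submodule.span ℝ (Set.range C) with hA
  set a := A.starProjection d with ha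
  have hreal : ((n : ℝ) + m + 2 ≤ finrank ℝ E) := by exact_mod_cast h
  have hn0 : (0 : ℝ) ≤ n := n.cast_nonneg
  refine integrable_and_integral_of_lintegral_ofReal ?_
    (Filter.Eventually.of_forall fun B => sq_nonneg _) ?_ ?_
  · exact ((measurable_memoryCorrection measurable_const measurable_id
      d).norm.pow_const 2).aestronglyMeasurable
  · have h1 : 0 ≤ (finrank ℝ E : ℝ) - m - 1 := by linarith
    have h2 : 0 ≤ (finrank ℝ E : ℝ) - (n + m) - 1 := by linarith
    positivity
  rcases eq_or_ne a 0 with ha0 | ha0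
  · have hzero : ∀ B : Fin n → E, memoryCorrection C B d = 0 := fun B => by
      have hy : (Sum.elim (fun i => -⟪C i, d⟫) 0 : Fin m ⊕ Fin n → ℝ) = 0 := by
        ext k
        rcases k with i | j
        · have hi : C i ∈ A := Submodule.subset_span ⟨i, rfl⟩
          have : ⟪C i, a⟫ = ⟪C i, d⟫ := by
            rw [ha, ← Submodule.inner_starProjection_left_eq_right,
              Submodule.starProjection_eq_self_iff.2 hi]
          simp [← this, ha0]
        · rfl
      rw [memoryCorrection, hy, minNormInterp, Matrix.mulVec_zero]
      simp
    simp [hzero, ha0]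
  set V := (ℝ ∙ a)ᗮ ⊓ A with hV
  have haA : a ∈ A := Submodule.starProjection_apply_mem _ _
  have haV : a ∈ Vᗮ := by
    rw [Submodule.mem_orthogonal]
    intro u hu
    exact (Submodule.mem_orthogonal' _ _).1 (Submodule.mem_inf.1 hu).1 a
      (Submodule.mem_span_singleton_self a)
  -- Removing the line of `a` from the `m`-dimensional `A` leaves dimension `m - 1` for `V`.
  have hd : finrank ℝ Vᗮ + m = finrank ℝ E + 1 := by
    have h1 := Submodule.finrank_add_inf_finrank_orthogonal
      ((Submodule.span_singleton_le_iff_mem a A).2 haA)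
    rw [finrank_span_singleton ha0, ← hV, finrank_span_eq_card hC, Fintype.card_fin] at h1
    have h2 := Submodule.finrank_add_finrank_orthogonal V
    omega
  have hd' : (finrank ℝ Vᗮ : ℝ) = (finrank ℝ E : ℝ) + 1 - m := by
    have : (finrank ℝ Vᗮ : ℝ) + m = finrank ℝ E + 1 := by exact_mod_cast hd
    linarith
  have hav0 : (⟨a, haV⟩ : Vᗮ) ≠ 0 := fun h0 => ha0 (congrArg Subtype.val h0)
  have hinv := lintegral_inv_residual_sq (n := n) (E := Vᗮ) (by omega) hav0
  have hmeas : Measurable fun B : Fin n → Vᗮ =>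
      (ENNReal.ofReal (‖residual B ⟨a, haV⟩‖ ^ 2))⁻¹ :=
    ((measurable_residual measurable_id measurable_const).norm.pow_const 2).ennreal_ofReal.inv
  have hne : ∀ᵐ B ∂gaussianFamily Vᗮ n, residual B (⟨a, haV⟩ : Vᗮ) ≠ 0 := by
    -- The inverse of 0 is infinite in `ℝ≥0∞`, so a finite mean forces a nonzero residual almost
    -- surely.
    have := ae_lt_top hmeas (by rw [hinv]; exact ENNReal.ofReal_ne_top)
    filter_upwards [this] with B hB h0
    simp [h0] at hB
  have hne' := (measurePreserving_orthogonalProjection (n := n) Vᗮ).quasiMeasurePreserving.ae hne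
  rw [← (measurePreserving_orthogonalProjection Vᗮ).lintegral_comp hmeas] at hinv
  have hcongr : ∫⁻ B, ENNReal.ofReal (‖memoryCorrection C B d‖ ^ 2) ∂gaussianFamily E n
      = ∫⁻ B, ENNReal.ofReal (‖a‖ ^ 4) * (ENNReal.ofReal (‖residual
        (fun j => Vᗮ.orthogonalProjectionOnto (B j)) ⟨a, haV⟩‖ ^ 2))⁻¹ ∂gaussianFamily E n := by
    refine lintegral_congr_ae ?_
    filter_upwards [hne', ae_linearIndependent_elim hC (n := n) (by omega),
      ae_linearIndependent_projection (n := n) Vᗮ (by omega)] with B h1 h2 h3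
    rw [norm_sq_memoryCorrection h2 ha hV h3 haV h1,
      ENNReal.ofReal_div_of_pos (pow_pos (norm_pos_iff.2 h1) 2), div_eq_mul_inv]
  rw [hcongr, lintegral_const_mul' _ _ ENNReal.ofReal_ne_top, hinv, ← ENNReal.ofReal_mul (by positivity)]
  congr 1
  have hna : ‖(⟨a, haV⟩ : Vᗮ)‖ = ‖a‖ := rfl
  have hna0 : ‖a‖ ≠ 0 := norm_ne_zero_iff.2 ha0
  have e1 : (finrank ℝ E : ℝ) + 1 - m - 2 = (finrank ℝ E : ℝ) - m - 1 := by ring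
  have e2 : (finrank ℝ E : ℝ) + 1 - m - n - 2 = (finrank ℝ E : ℝ) - (n + m) - 1 := by ring
  rw [hna, hd', e1, e2]
  field_simp

/-- The component of `d` in `A` contributes the constant `-‖A.starProjection d‖²` by the defining
equations of the correction; the component in `Aᗮ` contributes 0 by symmetry under reflection. -/
lemma integral_inner_memoryCorrection {C : Fin m → E} (hC : LinearIndependent ℝ C)
    (h : n + m + 2 ≤ finrank ℝ E) (d : E) :
    Integrable (fun B => ⟪memoryCorrection C B d, d⟫) (gaussianFamily E n) ∧
    ∫ B, ⟪memoryCorrection C B d, d⟫ ∂gaussianFamily E n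
      = -‖(Submodule.span ℝ (Set.range C)).starProjection d‖ ^ 2 := by
  set A := Submodule.span ℝ (Set.range C) with hA
  have hmeas : ∀ e : E, Measurable fun B : Fin n → E => ⟪memoryCorrection C B d, e⟫ := fun e =>
    (measurable_memoryCorrection measurable_const measurable_id d).inner measurable_const
  have hLp : MemLp (fun B => memoryCorrection C B d) 2 (gaussianFamily E n) := by
    have hm : Measurable fun B : Fin n → E => memoryCorrection C B d :=
      measurable_memoryCorrection measurable_const measurable_id d
    rw [memLp_two_iff_integrable_sq_norm hm.aestronglyMeasurable]
    exact (integral_memoryCorrection_sq hC h d).1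
  have hint : ∀ e : E, Integrable (fun B => ⟪memoryCorrection C B d, e⟫) (gaussianFamily E n) :=
    fun e => (hLp.integrable one_le_two).inner_const e
  refine ⟨hint d, ?_⟩
  have hLI := ae_linearIndependent_elim hC (n := n) (by omega)
  have hmp := measurePreserving_isometry (n := n) (Aᗮ.reflection)
  -- Reflecting `B` in `Aᗮ` preserves its law and changes the sign of the integrand, so the integral
  -- equals its own negative.
  have hsymm : ∫ B, ⟪memoryCorrection C B d, Aᗮ.starProjection d⟫ ∂gaussianFamily E n = 0 := by
    have h1 : ∫ B, ⟪memoryCorrection C B d, Aᗮ.starProjection d⟫ ∂gaussianFamily E n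
        = ∫ B, -⟪memoryCorrection C B d, Aᗮ.starProjection d⟫ ∂gaussianFamily E n := by
      nth_rw 1 [← hmp.map_eq]
      rw [integral_map hmp.measurable.aemeasurable (hmeas _).aestronglyMeasurable]
      refine integral_congr_ae ?_
      filter_upwards [hLI, hmp.quasiMeasurePreserving.ae hLI] with B hB hB'
      have hr : Aᗮ.starProjection d = Aᗮ.reflection (Aᗮ.starProjection d) :=
        ((Submodule.reflection_eq_self_iff _).2 (Submodule.starProjection_apply_mem _ _)).symm
      rw [memoryCorrection_reflection hB d hB', inner_neg_left, hr,
        LinearIsometryEquiv.inner_map_map, ← hr]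
    rw [integral_neg] at h1
    linarith
  have hsplit : ∀ᵐ B ∂gaussianFamily E n, ⟪memoryCorrection C B d, d⟫
      = -‖A.starProjection d‖ ^ 2 + ⟪memoryCorrection C B d, Aᗮ.starProjection d⟫ := by
    filter_upwards [hLI] with B hB
    have h1 := inner_memoryCorrection_left hB d (Submodule.starProjection_apply_mem A d)
    have h2 : ⟪A.starProjection d, d⟫ = ‖A.starProjection d‖ ^ 2 := by
      rw [← real_inner_self_eq_norm_sq, A.inner_starProjection_left_eq_right,
        A.inner_starProjection_left_eq_right,
        Submodule.starProjection_eq_self_iff.2 (Submodule.starProjection_apply_mem A d)]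
    nth_rw 2 [← A.starProjection_add_starProjection_orthogonal d]
    rw [inner_add_right, real_inner_comm, h1, h2]
  rw [integral_congr_ae hsplit, integral_add (integrable_const _) (hint _), hsymm]
  simp

omit [MeasurableSpace E] [BorelSpace E] in
lemma norm_sq_projection_add_orthogonal (A : Submodule ℝ E) (d : E) :
    ‖A.starProjection d‖ ^ 2 + ‖Aᗮ.starProjection d‖ ^ 2 = ‖d‖ ^ 2 :=
  (A.norm_sq_eq_add_norm_sq_starProjection d).symm

/-- Mean loss on the first task given its data: `r` is the error after the first task and `d` the
difference of the ground truths. -/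
lemma integral_first_loss {C : Fin m → E} (hC : LinearIndependent ℝ C)
    (h : n + m + 2 ≤ finrank ℝ E) {r : E}
    (hr : r ∈ (Submodule.span ℝ (Set.range C))ᗮ) (d : E) :
    Integrable (fun B => ‖d + memoryCorrection C B d - residual (Sum.elim C B) (r + d)‖ ^ 2)
      (gaussianFamily E n) ∧
    ∫ B, ‖d + memoryCorrection C B d - residual (Sum.elim C B) (r + d)‖ ^ 2 ∂gaussianFamily E n
      = (1 - n / ((finrank ℝ E : ℝ) - m)) * ‖r‖ ^ 2 + ‖d‖ ^ 2
        - (1 - n / ((finrank ℝ E : ℝ) - m))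
          * ‖(Submodule.span ℝ (Set.range C))ᗮ.starProjection d‖ ^ 2
        + (n / ((finrank ℝ E : ℝ) - (n + m) - 1) - 1)
          * (‖d‖ ^ 2 - ‖(Submodule.span ℝ (Set.range C))ᗮ.starProjection d‖ ^ 2) := by
  have hreal : ((n : ℝ) + m + 2 ≤ finrank ℝ E) := by exact_mod_cast h
  have hn0 : (0 : ℝ) ≤ n := n.cast_nonneg
  obtain ⟨i1, v1⟩ := integral_residual_elim_sq hC (n := n) (by omega) r
  obtain ⟨i2, v2⟩ := integral_residual_elim_sq hC (n := n) (by omega) d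
  obtain ⟨i3, v3⟩ := integral_memoryCorrection_sq hC h d
  obtain ⟨i4, v4⟩ := integral_inner_memoryCorrection hC h d
  have hexp : (fun B : Fin n → E =>
      ‖d + memoryCorrection C B d - residual (Sum.elim C B) (r + d)‖ ^ 2)
      =ᵐ[gaussianFamily E n] fun B => ‖residual (Sum.elim C B) r‖ ^ 2 + ‖d‖ ^ 2
        - ‖residual (Sum.elim C B) d‖ ^ 2 + 2 * ⟪memoryCorrection C B d, d⟫
        + ‖memoryCorrection C B d‖ ^ 2 := by
    filter_upwards [ae_linearIndependent_elim hC (n := n) (by omega)] with B hB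
    have ht := inner_mem_span_residual hB
    have htr := ht r (memoryCorrection_mem_span C B d)
    have htd := ht d (memoryCorrection_mem_span C B d)
    -- This gives `⟪d, R r⟫ = ⟪R d, R r⟫`, whence the cross terms in `R r` and `R d` cancel in the
    -- expansion.
    have hpr : ⟪d - residual (Sum.elim C B) d, residual (Sum.elim C B) r⟫ = 0 := by
      refine ht r ?_
      rw [residual, sub_sub_cancel]
      exact minNormInterp_mem_span _ _
    have hdd := inner_self_residual hB d
    rw [residual_add]
    generalize memoryCorrection C B d = t at *
    generalize residual (Sum.elim C B) d = ρd at *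
    generalize residual (Sum.elim C B) r = ρr at *
    simp only [← real_inner_self_eq_norm_sq, inner_add_left, inner_add_right, inner_sub_left,
      inner_sub_right] at *
    rw [real_inner_comm t d, real_inner_comm ρr d, real_inner_comm ρr ρd, real_inner_comm ρr t,
      real_inner_comm ρd d, real_inner_comm ρd t] at *
    linarith
  have hi := ((((i1.add (integrable_const (‖d‖ ^ 2))).sub i2).add (i4.const_mul 2)).add i3)
  refine ⟨hi.congr hexp.symm, ?_⟩
  rw [integral_congr_ae hexp, integral_add (by fun_prop) (by fun_prop),
    integral_add (by fun_prop) (by fun_prop), integral_sub (by fun_prop) (by fun_prop),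
    integral_add (by fun_prop) (by fun_prop), integral_const_mul, v1, v2, v3, v4,
    Submodule.starProjection_eq_self_iff.2 hr]
  rw [← norm_sq_projection_add_orthogonal (Submodule.span ℝ (Set.range C)) d]
  have h1 : (finrank ℝ E : ℝ) - m ≠ 0 := by linarith
  have h2 : (finrank ℝ E : ℝ) - (n + m) - 1 ≠ 0 := by linarith
  simp only [integral_const, probReal_univ, smul_eq_mul, one_mul]
  field_simp
  ring

/-- Mean loss on the second task given the data of the first one. -/
lemma integral_second_loss {C : Fin m → E} (hC : LinearIndependent ℝ C)
    (h : n + m + 2 ≤ finrank ℝ E) (r d : E) :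
    Integrable (fun B => ‖memoryCorrection C B d - residual (Sum.elim C B) (r + d)‖ ^ 2)
      (gaussianFamily E n) ∧
    ∫ B, ‖memoryCorrection C B d - residual (Sum.elim C B) (r + d)‖ ^ 2 ∂gaussianFamily E n
      = (1 + n / ((finrank ℝ E : ℝ) - (n + m) - 1))
          * (‖d‖ ^ 2 - ‖(Submodule.span ℝ (Set.range C))ᗮ.starProjection d‖ ^ 2)
        + (1 - n / ((finrank ℝ E : ℝ) - m))
          * ‖(Submodule.span ℝ (Set.range C))ᗮ.starProjection (r + d)‖ ^ 2 := by
  have hreal : ((n : ℝ) + m + 2 ≤ finrank ℝ E) := by exact_mod_cast h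
  have hn0 : (0 : ℝ) ≤ n := n.cast_nonneg
  obtain ⟨i1, v1⟩ := integral_residual_elim_sq hC (n := n) (by omega) (r + d)
  obtain ⟨i3, v3⟩ := integral_memoryCorrection_sq hC h d
  have hexp : (fun B : Fin n → E =>
      ‖memoryCorrection C B d - residual (Sum.elim C B) (r + d)‖ ^ 2)
      =ᵐ[gaussianFamily E n] fun B => ‖memoryCorrection C B d‖ ^ 2
        + ‖residual (Sum.elim C B) (r + d)‖ ^ 2 := by
    filter_upwards [ae_linearIndependent_elim hC (n := n) (by omega)] with B hB
    have ht := inner_mem_span_residual hB (r + d) (memoryCorrection_mem_span C B d)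
    rw [norm_sub_sq_real, ht]
    ring
  refine ⟨(i3.add i1).congr hexp.symm, ?_⟩
  rw [integral_congr_ae hexp, integral_add i3 i1, v1, v3]
  rw [← norm_sq_projection_add_orthogonal (Submodule.span ℝ (Set.range C)) d]
  have h1 : (finrank ℝ E : ℝ) - m ≠ 0 := by linarith
  have h2 : (finrank ℝ E : ℝ) - (n + m) - 1 ≠ 0 := by linarith
  field_simp
  ring

end Expectation

/-! ### Joint law of the features of both tasks. -/

section Law

lemma map_family_eq_gaussianFamily {Ω : Type*} [MeasurableSpace Ω] {μ : Measure Ω}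
    [IsProbabilityMeasure μ] {E : Type*} [NormedAddCommGroup E] [InnerProductSpace ℝ E]
    [FiniteDimensional ℝ E] [MeasurableSpace E] [BorelSpace E] {κ : Type*} {f : κ → Ω → E}
    (hlaw : ∀ k, HasLaw (f k) (stdGaussian E) μ) (hind : iIndepFun f μ) {n : ℕ} {g : Fin n → κ}
    (hg : g.Injective) :
    μ.map (fun ω i => f (g i) ω) = gaussianFamily E n := by
  rw [(hind.precomp hg).map_fun_eq_pi_map fun i => (hlaw (g i)).aemeasurable]
  simp only [(hlaw _).map_eq]

variable {E : Type*} [NormedAddCommGroup E] [InnerProductSpace ℝ E] [FiniteDimensional ℝ E]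
  [MeasurableSpace E] [BorelSpace E] {m n : ℕ}

lemma measurePreserving_subfamily {g : Fin m → Fin n} (hg : g.Injective) :
    MeasurePreserving (fun X : Fin n → E => fun k => X (g k)) (gaussianFamily E n)
      (gaussianFamily E m) := by
  refine ⟨by fun_prop, ?_⟩
  refine map_family_eq_gaussianFamily (f := fun i (X : Fin n → E) => X i) (fun i => ?_) ?_ hg
  · exact ⟨(measurable_pi_apply i).aemeasurable, (measurePreserving_eval _ i).map_eq⟩
  · exact iIndepFun_pi (X := fun _ x => x) fun _ => aemeasurable_id

lemma map_tasks_eq_prod {Ω : Type*} [MeasurableSpace Ω] {μ : Measure Ω} [IsProbabilityMeasure μ]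
    {x : Fin 2 → Fin n → Ω → E} (hlaw : ∀ t i, HasLaw (x t i) (stdGaussian E) μ)
    (hind : iIndepFun (fun ti : Fin 2 × Fin n => x ti.1 ti.2) μ) :
    μ.map (fun ω => (fun i => x 0 i ω, fun i => x 1 i ω))
      = (gaussianFamily E n).prod (gaussianFamily E n) := by
  have hm : ∀ ti : Fin 2 × Fin n, AEMeasurable (x ti.1 ti.2) μ := fun ti =>
    (hlaw ti.1 ti.2).aemeasurable
  have hmt : ∀ t, AEMeasurable (fun ω i => x t i ω) μ := fun t =>
    aemeasurable_pi_lambda _ fun i => hm (t, i)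
  have hI := hind.indepFun_finset₀ (Finset.univ.filter fun ti => ti.1 = 0)
    (Finset.univ.filter fun ti => ti.1 = 1)
    (Finset.disjoint_filter.2 fun ti _ h0 h1 => by simp [h0] at h1) hm
  have hI' : IndepFun (fun ω i => x 0 i ω) (fun ω i => x 1 i ω) μ :=
    hI.comp (φ := fun X i => X ⟨(0, i), by simp⟩) (ψ := fun X i => X ⟨(1, i), by simp⟩)
      (measurable_pi_lambda _ fun i => measurable_pi_apply _)
      (measurable_pi_lambda _ fun i => measurable_pi_apply _)
  rw [(indepFun_iff_map_prod_eq_prod_map_map (hmt 0) (hmt 1)).1 hI']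
  have hl : ∀ t : Fin 2, μ.map (fun ω i => x t i ω) = gaussianFamily E n := fun t =>
    map_family_eq_gaussianFamily (f := fun ti : Fin 2 × Fin n => x ti.1 ti.2)
      (fun ti => hlaw ti.1 ti.2) hind (g := fun i => (t, i)) (fun i j h => (Prod.ext_iff.1 h).2)
  rw [hl, hl]

end Law

/-! ### Expected losses after the second task. -/

section TwoTasks

variable {E : Type*} [NormedAddCommGroup E] [InnerProductSpace ℝ E] {m n : ℕ}

/-- The weights after the second task: `X` and `Y` are the features of the two tasks, `g` lists the
memory and `u`, `v` are the ground truths. -/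
noncomputable def secondWeights (g : Fin m → Fin n) (u v : E) (X Y : Fin n → E) : E :=
  v + memoryCorrection (fun k => X (g k)) Y (v - u)
    - residual (Sum.elim (fun k => X (g k)) Y) (residual X u + (v - u))

variable [FiniteDimensional ℝ E] [MeasurableSpace E] [BorelSpace E]

lemma measurable_secondWeights (g : Fin m → Fin n) (u v : E) :
    Measurable fun q : (Fin n → E) × (Fin n → E) => secondWeights g u v q.1 q.2 := by
  have hC : Measurable fun q : (Fin n → E) × (Fin n → E) => fun k => q.1 (g k) := by fun_prop
  have h1 := measurable_memoryCorrection hC measurable_snd (v - u)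
  have h2 : Measurable fun q : (Fin n → E) × (Fin n → E) => residual q.1 u :=
    measurable_residual measurable_fst measurable_const
  have h3 := measurable_residual (measurable_sumElim hC measurable_snd) (h2.add_const (v - u))
  exact (h1.const_add v).sub h3

lemma integral_residual_sq (hn : n ≤ finrank ℝ E) (v : E) :
    Integrable (fun X => ‖residual X v‖ ^ 2) (gaussianFamily E n) ∧
    ∫ X, ‖residual X v‖ ^ 2 ∂gaussianFamily E n
      = ((finrank ℝ E : ℝ) - n) / finrank ℝ E * ‖v‖ ^ 2 := by
  refine integrable_and_integral_of_lintegral_ofReal ?_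
    (Filter.Eventually.of_forall fun B => sq_nonneg _) ?_ (lintegral_residual_sq hn v)
  · exact ((measurable_residual measurable_id measurable_const).norm.pow_const 2).aestronglyMeasurable
  · have : (0 : ℝ) ≤ (finrank ℝ E : ℝ) - n := by
      rw [sub_nonneg]
      exact_mod_cast hn
    positivity

lemma integral_projection_sq {g : Fin m → Fin n} (hg : g.Injective) (hm : m ≤ finrank ℝ E)
    (v : E) :
    Integrable (fun X : Fin n → E =>
      ‖(Submodule.span ℝ (Set.range fun k => X (g k)))ᗮ.starProjection v‖ ^ 2)
      (gaussianFamily E n) ∧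
    ∫ X, ‖(Submodule.span ℝ (Set.range fun k => X (g k)))ᗮ.starProjection v‖ ^ 2
      ∂gaussianFamily E n = ((finrank ℝ E : ℝ) - m) / finrank ℝ E * ‖v‖ ^ 2 := by
  have hmp := measurePreserving_subfamily (E := E) hg
  obtain ⟨hi, hv⟩ := integral_residual_sq hm v
  have hcongr : (fun X : Fin n → E => ‖residual (fun k => X (g k)) v‖ ^ 2)
      =ᵐ[gaussianFamily E n] fun X =>
        ‖(Submodule.span ℝ (Set.range fun k => X (g k)))ᗮ.starProjection v‖ ^ 2 := by
    filter_upwards [hmp.quasiMeasurePreserving.ae (ae_linearIndependent m hm)] with X hX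
    rw [norm_residual_eq hX]
    rfl
  refine ⟨(hmp.integrable_comp_of_integrable hi).congr hcongr, ?_⟩
  rw [← integral_congr_ae hcongr, ← hv]
  conv_rhs => rw [← hmp.map_eq, integral_map hmp.measurable.aemeasurable
    (by rw [hmp.map_eq]; exact hi.aestronglyMeasurable)]

/-- For a nonnegative `f` the inner integrals are also the inner `L¹` norms, so integrability of the
conditional mean yields joint integrability. -/
lemma integrable_and_integral_prod {X Y : Type*} [MeasurableSpace X] [MeasurableSpace Y]
    {μ : Measure X} {ν : Measure Y} [SFinite μ] [SFinite ν] {f : X × Y → ℝ} (hf : Measurable f)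
    (hf0 : ∀ q, 0 ≤ f q) {F : X → ℝ} (hF : Integrable F μ)
    (h : ∀ᵐ x ∂μ, Integrable (fun y => f (x, y)) ν ∧ ∫ y, f (x, y) ∂ν = F x) :
    Integrable f (μ.prod ν) ∧ ∫ q, f q ∂(μ.prod ν) = ∫ x, F x ∂μ := by
  have hint : Integrable f (μ.prod ν) := by
    rw [integrable_prod_iff hf.aestronglyMeasurable]
    refine ⟨h.mono fun x hx => hx.1, hF.congr ?_⟩
    filter_upwards [h] with x hx
    simp only [Real.norm_of_nonneg (hf0 _), hx.2]
  refine ⟨hint, ?_⟩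
  rw [integral_prod _ hint]
  exact integral_congr_ae (h.mono fun x hx => hx.2)

omit [FiniteDimensional ℝ E] [MeasurableSpace E] [BorelSpace E] in
lemma residual_mem_orthogonal {X : Fin n → E} (hX : LinearIndependent ℝ X) (g : Fin m → Fin n)
    (u : E) : residual X u ∈ (Submodule.span ℝ (Set.range fun k => X (g k)))ᗮ := by
  rw [Submodule.mem_orthogonal]
  intro c hc
  exact inner_eq_zero_of_mem_span (fun k => inner_residual hX u (g k)) hc

theorem integral_first_loss_secondWeights {g : Fin m → Fin n} (hg : g.Injective)
    (h : n + m + 2 ≤ finrank ℝ E) (u v : E) :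
    Integrable (fun q : (Fin n → E) × (Fin n → E) => ‖secondWeights g u v q.1 q.2 - u‖ ^ 2)
      ((gaussianFamily E n).prod (gaussianFamily E n)) ∧
    ∫ q : (Fin n → E) × (Fin n → E), ‖secondWeights g u v q.1 q.2 - u‖ ^ 2
      ∂((gaussianFamily E n).prod (gaussianFamily E n))
      = (n : ℝ) / finrank ℝ E * (1 + (m : ℝ) / ((finrank ℝ E : ℝ) - (n + m) - 1)) * ‖u - v‖ ^ 2
        + (1 - (n : ℝ) / ((finrank ℝ E : ℝ) - m)) * (1 - (n : ℝ) / finrank ℝ E) * ‖u‖ ^ 2 := by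
  have hreal : ((n : ℝ) + m + 2 ≤ finrank ℝ E) := by exact_mod_cast h
  have hn0 : (0 : ℝ) ≤ n := n.cast_nonneg
  have hm0 : (0 : ℝ) ≤ m := m.cast_nonneg
  obtain ⟨i1, v1⟩ := integral_residual_sq (n := n) (by omega) u
  obtain ⟨i2, v2⟩ := integral_projection_sq hg (by omega) (v - u)
  -- Integrability of the conditional mean given `X`, assembled in the shape of
  -- `integral_first_loss`.
  have hF := (((i1.const_mul (1 - n / ((finrank ℝ E : ℝ) - m))).add
    (integrable_const (‖v - u‖ ^ 2))).sub
      (i2.const_mul (1 - n / ((finrank ℝ E : ℝ) - m)))).add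
    (((integrable_const (‖v - u‖ ^ 2)).sub i2).const_mul
      (n / ((finrank ℝ E : ℝ) - (n + m) - 1) - 1))
  obtain ⟨hi, hv⟩ := integrable_and_integral_prod (μ := gaussianFamily E n)
    (ν := gaussianFamily E n)
    (f := fun q : (Fin n → E) × (Fin n → E) => ‖secondWeights g u v q.1 q.2 - u‖ ^ 2)
    (((measurable_secondWeights g u v).sub_const u).norm.pow_const 2)
    (fun q => sq_nonneg _) hF (by
      filter_upwards [ae_linearIndependent n (E := E) (by omega)] with X hX
      have hw : ∀ Y, secondWeights g u v X Y - u
          = v - u + memoryCorrection (fun k => X (g k)) Y (v - u)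
            - residual (Sum.elim (fun k => X (g k)) Y) (residual X u + (v - u)) := fun Y => by
        rw [secondWeights]
        abel
      simp only [hw]
      exact integral_first_loss (hX.comp g hg) h (residual_mem_orthogonal hX g u) (v - u))
  refine ⟨hi, ?_⟩
  rw [hv]
  simp only [Pi.add_apply, Pi.sub_apply]
  rw [integral_add (by fun_prop) (by fun_prop), integral_sub (by fun_prop) (by fun_prop),
    integral_add (by fun_prop) (by fun_prop), integral_const_mul, integral_const_mul,
    integral_const_mul, integral_sub (by fun_prop) (by fun_prop), v1, v2, norm_sub_rev u v]
  have h1 : (finrank ℝ E : ℝ) - m ≠ 0 := by linarith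
  have h2 : (finrank ℝ E : ℝ) - (n + m) - 1 ≠ 0 := by linarith
  have h3 : (finrank ℝ E : ℝ) ≠ 0 := by linarith
  simp only [integral_const, probReal_univ, smul_eq_mul, one_mul]
  field_simp
  ring

theorem integral_second_loss_secondWeights {g : Fin m → Fin n} (hg : g.Injective)
    (h : n + m + 2 ≤ finrank ℝ E) {u v : E} (huv : ‖u‖ = ‖v‖) :
    Integrable (fun q : (Fin n → E) × (Fin n → E) => ‖secondWeights g u v q.1 q.2 - v‖ ^ 2)
      ((gaussianFamily E n).prod (gaussianFamily E n)) ∧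
    ∫ q : (Fin n → E) × (Fin n → E), ‖secondWeights g u v q.1 q.2 - v‖ ^ 2
      ∂((gaussianFamily E n).prod (gaussianFamily E n))
      = (n : ℝ) / finrank ℝ E * (1 - ((n : ℝ) - m) / ((finrank ℝ E : ℝ) - m)
          + (m : ℝ) / ((finrank ℝ E : ℝ) - (n + m) - 1)) * ‖u - v‖ ^ 2
        + (1 - (n : ℝ) / ((finrank ℝ E : ℝ) - m)) * (1 - (n : ℝ) / finrank ℝ E) * ‖u‖ ^ 2 := by
  have hreal : ((n : ℝ) + m + 2 ≤ finrank ℝ E) := by exact_mod_cast h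
  have hn0 : (0 : ℝ) ≤ n := n.cast_nonneg
  have hm0 : (0 : ℝ) ≤ m := m.cast_nonneg
  obtain ⟨i1, v1⟩ := integral_residual_sq (n := n) (E := E) (by omega) v
  obtain ⟨i2, v2⟩ := integral_residual_sq (n := n) (E := E) (by omega) (v - u)
  obtain ⟨i3, v3⟩ := integral_projection_sq hg (by omega) (v - u)
  have hF := (((integrable_const (‖v - u‖ ^ 2)).sub i3).const_mul
      (1 + n / ((finrank ℝ E : ℝ) - (n + m) - 1))).add
    (((i1.sub i2).add i3).const_mul (1 - n / ((finrank ℝ E : ℝ) - m)))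
  obtain ⟨hi, hv⟩ := integrable_and_integral_prod (μ := gaussianFamily E n)
    (ν := gaussianFamily E n)
    (f := fun q : (Fin n → E) × (Fin n → E) => ‖secondWeights g u v q.1 q.2 - v‖ ^ 2)
    (((measurable_secondWeights g u v).sub_const v).norm.pow_const 2)
    (fun q => sq_nonneg _) hF (by
      filter_upwards [ae_linearIndependent n (E := E) (by omega)] with X hX
      have hw : ∀ Y, secondWeights g u v X Y - v
          = memoryCorrection (fun k => X (g k)) Y (v - u)
            - residual (Sum.elim (fun k => X (g k)) Y) (residual X u + (v - u)) := fun Y => by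
        rw [secondWeights]
        abel
      simp only [hw]
      have hm := residual_mem_orthogonal hX g u
      have key := integral_second_loss (hX.comp g hg) h (residual X u) (v - u)
      refine ⟨key.1, key.2.trans ?_⟩
      -- The cross term `⟪residual X u, v - u⟫` occurs both here and in the expansion of `‖residual
      -- X v‖²`; trading one for the other leaves only squared norms of known mean.
      have hproj : ‖(Submodule.span ℝ (Set.range fun k => X (g k)))ᗮ.starProjection
            (residual X u + (v - u))‖ ^ 2
          = ‖residual X v‖ ^ 2 - ‖residual X (v - u)‖ ^ 2
            + ‖(Submodule.span ℝ (Set.range fun k => X (g k)))ᗮ.starProjection (v - u)‖ ^ 2 := by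
        have hr : residual X v = residual X u + residual X (v - u) := by
          rw [← residual_add, add_sub_cancel]
        have h1 : ⟪residual X u, residual X (v - u)⟫ = ⟪residual X u, v - u⟫ := by
          nth_rw 2 [residual]
          rw [inner_sub_right, real_inner_comm, real_inner_comm (minNormInterp _ _),
            inner_mem_span_residual hX u (minNormInterp_mem_span _ _), sub_zero]
        have h2 : ⟪residual X u, (Submodule.span ℝ
            (Set.range fun k => X (g k)))ᗮ.starProjection (v - u)⟫ = ⟪residual X u, v - u⟫ := by
          rw [← Submodule.inner_starProjection_left_eq_right,
            Submodule.starProjection_eq_self_iff.2 hm]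
        rw [map_add, Submodule.starProjection_eq_self_iff.2 hm, norm_add_sq_real, h2, hr,
          norm_add_sq_real, h1]
        ring
      simp only [Pi.add_apply, Pi.sub_apply]
      rw [← hproj]
      rfl)
  refine ⟨hi, ?_⟩
  rw [hv]
  simp only [Pi.add_apply, Pi.sub_apply]
  -- The mean of `‖residual X v‖²` brings in `‖v‖²`; equality of norms turns it into `‖u‖²`.
  rw [integral_add (by fun_prop) (by fun_prop), integral_const_mul, integral_const_mul,
    integral_add (by fun_prop) (by fun_prop), integral_sub (by fun_prop) (by fun_prop),
    integral_sub (by fun_prop) (by fun_prop), v1, v2, v3, norm_sub_rev u v, ← huv]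
  have h1 : (finrank ℝ E : ℝ) - m ≠ 0 := by linarith
  have h2 : (finrank ℝ E : ℝ) - (n + m) - 1 ≠ 0 := by linarith
  have h3 : (finrank ℝ E : ℝ) ≠ 0 := by linarith
  simp only [integral_const, probReal_univ, smul_eq_mul, one_mul]
  field_simp
  ring

end TwoTasks

/-! ### Closed form of the learner's trajectory. -/

section Learner

/-- The nearest point of an affine subspace given by independent linear equations. -/
lemma nearest_iff {E : Type*} [NormedAddCommGroup E] [InnerProductSpace ℝ E] {ι : Type*}
    [Fintype ι] [DecidableEq ι] {Z : ι → E} (hZ : LinearIndependent ℝ Z) (y : ι → ℝ) (w₀ w : E) :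
    (w ∈ {v : E | ∀ i, ⟪Z i, v⟫ = y i} ∧
      IsMinOn (fun v => ‖v - w₀‖ ^ 2) {v : E | ∀ i, ⟪Z i, v⟫ = y i} w)
      ↔ w = w₀ + minNormInterp Z (fun i => y i - ⟪Z i, w₀⟫) := by
  set s := minNormInterp Z (fun i => y i - ⟪Z i, w₀⟫) with hs
  have hmem : w₀ + s ∈ {v : E | ∀ i, ⟪Z i, v⟫ = y i} := fun i => by
    rw [inner_add_right, hs, inner_minNormInterp hZ]
    ring
  have hpyth : ∀ v ∈ {v : E | ∀ i, ⟪Z i, v⟫ = y i},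
      ‖v - w₀‖ ^ 2 = ‖v - (w₀ + s)‖ ^ 2 + ‖s‖ ^ 2 := fun v hv => by
    have h0 : ⟪s, v - (w₀ + s)⟫ = 0 := inner_eq_zero_of_mem_span
      (fun i => by rw [inner_sub_right, hv i, hmem i, sub_self]) (minNormInterp_mem_span _ _)
    have : v - w₀ = s + (v - (w₀ + s)) := by abel
    rw [this, norm_add_sq_real, h0]
    ring
  constructor
  · rintro ⟨hw, hmin⟩
    have h1 := isMinOn_iff.1 hmin _ hmem
    rw [hpyth w hw, add_sub_cancel_left] at h1
    have h2 : ‖w - (w₀ + s)‖ ^ 2 = 0 := le_antisymm (by linarith) (sq_nonneg _)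
    exact sub_eq_zero.1 (norm_eq_zero.1 (pow_eq_zero_iff two_ne_zero |>.1 h2))
  · rintro rfl
    refine ⟨hmem, isMinOn_iff.2 fun v hv => ?_⟩
    rw [hpyth v hv, add_sub_cancel_left]
    linarith [sq_nonneg ‖v - (w₀ + s)‖]

variable {p m n : ℕ}

lemma isRegReplayLearner_iff {x : Fin 2 → Fin n → Vec p} {wstar : Fin 2 → Vec p}
    {z : Fin 2 → Fin n → ℝ} (hz : ∀ t i, z t i = 0) {S : Fin 2 → Finset (Fin n)}
    {g : Fin m → Fin n} (hg : ∀ i, i ∈ S 0 ↔ ∃ k, g k = i)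
    (hx : LinearIndependent ℝ (x 0))
    (hZ : LinearIndependent ℝ (Sum.elim (fun k => x 0 (g k)) (x 1)))
    (w : Fin 3 → Vec p) :
    IsRegReplayLearner x (labels wstar x z) S w ↔
      w = ![0, wstar 0 - residual (x 0) (wstar 0),
        secondWeights g (wstar 0) (wstar 1) (x 0) (x 1)] := by
  have hf0 : feasible x (labels wstar x z) S 0
      = {v : Vec p | ∀ i, ⟪x 0 i, v⟫ = ⟪x 0 i, wstar 0⟫} := by
    ext v
    simp [feasible, labels, hz]
  have hf1 : feasible x (labels wstar x z) S 1
      = {v : Vec p | ∀ i, ⟪Sum.elim (fun k => x 0 (g k)) (x 1) i, v⟫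
        = Sum.elim (fun k => ⟪x 0 (g k), wstar 0⟫) (fun j => ⟪x 1 j, wstar 1⟫) i} := by
    ext v
    simp only [feasible, labels, hz, add_zero, Set.mem_ofPred_eq, Sum.forall, Sum.elim_inl,
      Sum.elim_inr]
    rw [and_comm]
    refine and_congr_left fun _ => ⟨fun h k => h 0 (by decide) _ ((hg _).2 ⟨k, rfl⟩), ?_⟩
    intro h s hs i hi
    have hs0 : s = 0 := by omega
    subst hs0
    obtain ⟨k, rfl⟩ := (hg i).1 hi
    exact h k
  have e0 : (0 : Vec p) + minNormInterp (x 0) (fun i => ⟪x 0 i, wstar 0⟫ - ⟪x 0 i, (0 : Vec p)⟫)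
      = wstar 0 - residual (x 0) (wstar 0) := by
    simp [residual]
  have e1 : (wstar 0 - residual (x 0) (wstar 0))
      + minNormInterp (Sum.elim (fun k => x 0 (g k)) (x 1)) (fun i =>
        Sum.elim (fun k => ⟪x 0 (g k), wstar 0⟫) (fun j => ⟪x 1 j, wstar 1⟫) i
        - ⟪Sum.elim (fun k => x 0 (g k)) (x 1) i, wstar 0 - residual (x 0) (wstar 0)⟫)
      = secondWeights g (wstar 0) (wstar 1) (x 0) (x 1) := by
    -- The label defects of the first weights are those of `r + d` for every sample, less `⟪C i, d⟫`
    -- on the memory; the two terms give the projection of `r + d` and the memory correction.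
    have hy : (fun i : Fin m ⊕ Fin n =>
        Sum.elim (fun k => ⟪x 0 (g k), wstar 0⟫) (fun j => ⟪x 1 j, wstar 1⟫) i
        - ⟪Sum.elim (fun k => x 0 (g k)) (x 1) i, wstar 0 - residual (x 0) (wstar 0)⟫)
        = (fun i => ⟪Sum.elim (fun k => x 0 (g k)) (x 1) i,
            residual (x 0) (wstar 0) + (wstar 1 - wstar 0)⟫)
          + Sum.elim (fun k => -⟪x 0 (g k), wstar 1 - wstar 0⟫) 0 := by
      ext i
      rcases i with k | j
      · simp only [Sum.elim_inl, Pi.add_apply, inner_sub_right, inner_add_right,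
          inner_residual hx]
        ring
      · simp only [Sum.elim_inr, Pi.add_apply, Pi.zero_apply, inner_sub_right, inner_add_right]
        ring
    rw [hy, minNormInterp_add, secondWeights]
    nth_rw 3 [residual]
    rw [memoryCorrection]
    abel
  have h0 := nearest_iff hx (fun i => ⟪x 0 i, wstar 0⟫) 0
  have h1 := nearest_iff hZ (Sum.elim (fun k => ⟪x 0 (g k), wstar 0⟫)
    (fun j => ⟪x 1 j, wstar 1⟫)) (wstar 0 - residual (x 0) (wstar 0))
  simp only [e0] at h0
  simp only [e1] at h1
  rw [← hf0] at h0
  rw [← hf1] at h1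
  constructor
  · intro h
    have hw0 : w 0 = 0 := h.init
    have hn0 := h.nearest 0
    have hn1 := h.nearest 1
    have hw1 : w 1 = wstar 0 - residual (x 0) (wstar 0) :=
      (h0 (w 1)).1 ⟨h.fit 0, by
        have hc : w (Fin.castSucc (0 : Fin 2)) = 0 := hw0
        rw [hc] at hn0
        exact hn0⟩
    have hw2 : w 2 = secondWeights g (wstar 0) (wstar 1) (x 0) (x 1) :=
      (h1 (w 2)).1 ⟨h.fit 1, by
        have hc : w (Fin.castSucc (1 : Fin 2)) = wstar 0 - residual (x 0) (wstar 0) := hw1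
        rw [hc] at hn1
        exact hn1⟩
    ext t : 1
    fin_cases t
    · exact hw0
    · exact hw1
    · exact hw2
  · rintro rfl
    obtain ⟨a0, b0⟩ := (h0 _).2 rfl
    obtain ⟨a1, b1⟩ := (h1 _).2 rfl
    refine ⟨rfl, fun t => ?_, fun t => ?_⟩
    · fin_cases t
      · exact a0
      · exact a1
    · fin_cases t
      · exact b0
      · exact b1

lemma generalizationError_two (wstar : Fin 2 → Vec p) (w : Vec p) :
    generalizationError wstar w = 1 / 2 * (‖w - wstar 0‖ ^ 2 + ‖w - wstar 1‖ ^ 2) := by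
  simp [generalizationError, loss, Fin.sum_univ_two]

lemma forgetting_two (wstar : Fin 2 → Vec p) (w : Fin 3 → Vec p) :
    forgetting wstar w = ‖w 2 - wstar 0‖ ^ 2 - ‖w 1 - wstar 0‖ ^ 2 := by
  have h : (Finset.univ.filter fun t : Fin 2 => (t : ℕ) + 1 < 2) = {0} := by decide
  rw [forgetting, h, Finset.sum_singleton]
  have h1 : (1 : ℝ) / (((2 : ℕ) : ℝ) - 1) = 1 := by norm_num
  rw [h1, one_mul]
  rfl

end Learner

end ContinualLearning

/-! ### The expected generalization error and forgetting. -/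

theorem theorem4 {Ω : Type*} [MeasurableSpace Ω] (μ : Measure Ω) [IsProbabilityMeasure μ]
    (p n m : ℕ) (hp : n + m + 2 ≤ p)
    (wstar : Fin 2 → ContinualLearning.Vec p) (hnorm : ‖wstar 0‖ = ‖wstar 1‖)
    (x : Fin 2 → Fin n → Ω → ContinualLearning.Vec p) (z : Fin 2 → Fin n → Ω → ℝ)
    (hdata : ContinualLearning.IsGaussianData μ 0 x z)
    (S : Fin 2 → Finset (Fin n)) (hS : (S 0).card = m) :
    (∀ᵐ ω ∂μ, ∃! w : Fin 3 → ContinualLearning.Vec p,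
      ContinualLearning.IsRegReplayLearner (fun t i => x t i ω)
        (ContinualLearning.labels wstar (fun t i => x t i ω) (fun t i => z t i ω)) S w) ∧
    ∀ w : Ω → Fin 3 → ContinualLearning.Vec p,
      (∀ᵐ ω ∂μ, ContinualLearning.IsRegReplayLearner (fun t i => x t i ω)
        (ContinualLearning.labels wstar (fun t i => x t i ω) (fun t i => z t i ω)) S (w ω)) →
      (Integrable (fun ω => ContinualLearning.generalizationError wstar (w ω (Fin.last 2))) μ ∧
        ∫ ω, ContinualLearning.generalizationError wstar (w ω (Fin.last 2)) ∂μ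
          = (n : ℝ) / (2 * p) * (2 - ((n : ℝ) - m) / ((p : ℝ) - m)
              + 2 * (m : ℝ) / ((p : ℝ) - (n + m) - 1)) * ‖wstar 0 - wstar 1‖ ^ 2
            + (1 - (n : ℝ) / ((p : ℝ) - m)) * (1 - (n : ℝ) / p) * ‖wstar 0‖ ^ 2) ∧
      (Integrable (fun ω => ContinualLearning.forgetting wstar (w ω)) μ ∧
        ∫ ω, ContinualLearning.forgetting wstar (w ω) ∂μ
          = (n : ℝ) / p * (1 + (m : ℝ) / ((p : ℝ) - (n + m) - 1)) * ‖wstar 0 - wstar 1‖ ^ 2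
            - (n : ℝ) / ((p : ℝ) - m) * (1 - (n : ℝ) / p) * ‖wstar 0‖ ^ 2) := by
  open ContinualLearning in
  have hfin : Module.finrank ℝ (Vec p) = p := finrank_euclideanSpace_fin
  have hreal : ((n : ℝ) + m + 2 ≤ p) := by exact_mod_cast hp
  have hn0 : (0 : ℝ) ≤ n := n.cast_nonneg
  have hm0 : (0 : ℝ) ≤ m := m.cast_nonneg
  let g : Fin m → Fin n := (S 0).orderEmbOfFin hS
  have hginj : g.Injective := ((S 0).orderEmbOfFin hS).injective
  have hg : ∀ i, i ∈ S 0 ↔ ∃ k, g k = i := fun i => by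
    have := Set.ext_iff.1 ((S 0).range_orderEmbOfFin hS) i
    exact this.symm
  -- Noise of variance 0 has the Dirac law at 0, so the labels are almost surely exact.
  have hz : ∀ᵐ ω ∂μ, ∀ t i, z t i ω = 0 := by
    refine ae_all_iff.2 fun t => ae_all_iff.2 fun i => ?_
    have hl := hdata.noise_law t i
    have h0 : ∀ᵐ y ∂(gaussianReal 0 (0 ^ 2)), y = 0 := by
      simp [gaussianReal_zero_var, ae_dirac_eq]
    rw [← hl.map_eq] at h0
    exact ae_of_ae_map hl.aemeasurable h0
  have haem : AEMeasurable (fun ω => (fun i => x 0 i ω, fun i => x 1 i ω)) μ :=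
    (aemeasurable_pi_lambda _ fun i => (hdata.feature_law 0 i).aemeasurable).prodMk
      (aemeasurable_pi_lambda _ fun i => (hdata.feature_law 1 i).aemeasurable)
  have hlaw := map_tasks_eq_prod hdata.feature_law hdata.feature_indep
  have hLI : ∀ᵐ ω ∂μ, LinearIndependent ℝ (fun i => x 0 i ω) ∧
      LinearIndependent ℝ (Sum.elim (fun k => x 0 (g k) ω) (fun i => x 1 i ω)) := by
    have hmeas : MeasurableSet {q : (Fin n → Vec p) × (Fin n → Vec p) |
        LinearIndependent ℝ q.1 ∧ LinearIndependent ℝ (Sum.elim (fun k => q.1 (g k)) q.2)} :=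
      (measurableSet_linearIndependent measurable_fst).inter
        (measurableSet_linearIndependent (measurable_sumElim (by fun_prop) measurable_snd))
    have hprod : ∀ᵐ q ∂((gaussianFamily (Vec p) n).prod (gaussianFamily (Vec p) n)),
        LinearIndependent ℝ q.1 ∧ LinearIndependent ℝ (Sum.elim (fun k => q.1 (g k)) q.2) := by
      rw [Measure.ae_prod_iff_ae_ae hmeas]
      filter_upwards [ae_linearIndependent n (E := Vec p) (by omega)] with X hX
      filter_upwards [ae_linearIndependent_elim (hX.comp g hginj) (n := n) (by omega)] with Y hY
      exact ⟨hX, hY⟩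
    rw [← hlaw] at hprod
    exact ae_of_ae_map haem hprod
  have hiff : ∀ᵐ ω ∂μ, ∀ w : Fin 3 → Vec p, IsRegReplayLearner (fun t i => x t i ω)
        (labels wstar (fun t i => x t i ω) (fun t i => z t i ω)) S w ↔
      w = ![0, wstar 0 - residual (fun i => x 0 i ω) (wstar 0),
        secondWeights g (wstar 0) (wstar 1) (fun i => x 0 i ω) (fun i => x 1 i ω)] := by
    filter_upwards [hz, hLI] with ω h1 h2 w
    exact isRegReplayLearner_iff (x := fun t i => x t i ω) h1 hg h2.1 h2.2 w
  refine ⟨hiff.mono fun ω h => ⟨_, (h _).2 rfl, fun w hw => (h w).1 hw⟩, fun w hw => ?_⟩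
  have hwω : ∀ᵐ ω ∂μ, w ω = ![0, wstar 0 - residual (fun i => x 0 i ω) (wstar 0),
      secondWeights g (wstar 0) (wstar 1) (fun i => x 0 i ω) (fun i => x 1 i ω)] := by
    filter_upwards [hiff, hw] with ω h1 h2 using (h1 _).1 h2
  have htransfer : ∀ {f : (Fin n → Vec p) × (Fin n → Vec p) → ℝ} {c : ℝ},
      (Integrable f ((gaussianFamily (Vec p) n).prod (gaussianFamily (Vec p) n)) ∧
        ∫ q, f q ∂((gaussianFamily (Vec p) n).prod (gaussianFamily (Vec p) n)) = c) →
      Integrable (fun ω => f (fun i => x 0 i ω, fun i => x 1 i ω)) μ ∧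
        ∫ ω, f (fun i => x 0 i ω, fun i => x 1 i ω) ∂μ = c := by
    rintro f c ⟨hf, hc⟩
    rw [← hlaw] at hf hc
    exact ⟨hf.comp_aemeasurable haem, by rw [← hc, integral_map haem hf.aestronglyMeasurable]⟩
  obtain ⟨i1, v1⟩ := htransfer (integral_first_loss_secondWeights hginj
    (by rw [hfin]; exact hp) (wstar 0) (wstar 1))
  obtain ⟨i2, v2⟩ := htransfer (integral_second_loss_secondWeights hginj
    (by rw [hfin]; exact hp) hnorm)
  obtain ⟨i0, v0⟩ := htransfer (f := fun q => ‖residual q.1 (wstar 0)‖ ^ 2)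
    (c := ((p : ℝ) - n) / p * ‖wstar 0‖ ^ 2) (by
      obtain ⟨hi, hv⟩ := integral_residual_sq (n := n) (E := Vec p) (by omega) (wstar 0)
      rw [hfin] at hv
      refine ⟨hi.comp_fst _, ?_⟩
      rw [integral_fun_fst (fun X : Fin n → Vec p => ‖residual X (wstar 0)‖ ^ 2), hv]
      simp)
  rw [hfin] at v1 v2
  have h1 : (p : ℝ) - m ≠ 0 := by linarith
  have h2 : (p : ℝ) - (n + m) - 1 ≠ 0 := by linarith
  have h3 : (p : ℝ) ≠ 0 := by linarith
  have hG : (fun ω => generalizationError wstar (w ω (Fin.last 2))) =ᵐ[μ] fun ω => 1 / 2 *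
      (‖secondWeights g (wstar 0) (wstar 1) (fun i => x 0 i ω) (fun i => x 1 i ω) - wstar 0‖ ^ 2
      + ‖secondWeights g (wstar 0) (wstar 1) (fun i => x 0 i ω) (fun i => x 1 i ω)
        - wstar 1‖ ^ 2) := by
    filter_upwards [hwω] with ω hω
    rw [generalizationError_two, hω]
    rfl
  have hF : (fun ω => forgetting wstar (w ω)) =ᵐ[μ] fun ω =>
      ‖secondWeights g (wstar 0) (wstar 1) (fun i => x 0 i ω) (fun i => x 1 i ω) - wstar 0‖ ^ 2
      - ‖residual (fun i => x 0 i ω) (wstar 0)‖ ^ 2 := by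
    filter_upwards [hwω] with ω hω
    rw [forgetting_two, hω]
    have : ‖wstar 0 - residual (fun i => x 0 i ω) (wstar 0) - wstar 0‖
        = ‖residual (fun i => x 0 i ω) (wstar 0)‖ := by
      rw [sub_sub_cancel_left, norm_neg]
    rw [← this]
    rfl
  refine ⟨⟨((i1.add i2).const_mul (1 / 2)).congr hG.symm, ?_⟩, ⟨(i1.sub i0).congr hF.symm, ?_⟩⟩
  · rw [integral_congr_ae hG, integral_const_mul, integral_add i1 i2, v1, v2]
    field_simp
    ring
  · rw [integral_congr_ae hF, integral_sub i1 i0, v1, v0]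
    field_simp
    ring
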